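/- Let $\zeta$ denote the Riemann zeta function, meromorphically continued to $\mathbb{C}$. Every non-real zero of its derivative $\zeta'$ lies in the open right half-plane: if $s\in\mathbb{C}$ satisfies $\operatorname{Im} s\neq 0$ and $\zeta'(s)=0$, then $\operatorname{Re} s>0$. -/

import Mathlib

open Complex Metric Filter Topology

/-! By conjugation it suffices to exclude `ζ'(s) = 0` with `Re s ≤ 0 < Im s`. There ξ(s) ≠ 0, hence
ζ(s) ≠ 0, and logarithmic differentiation of ξ(s) = s(s-1)/2 · π^(-s/2) Γ(s/2) ζ(s) gives ξ'/ξ(s) +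
1/(1-s) + (log π)/2 - ψ(s/2+1)/2 = 0 (`xiLogDeriv_add_eq_zero`). This is contradicted in four
regions. For Im s ≥ 8, Re ψ is too large, as Re ξ'/ξ ≤ 0. For 3 ≤ Im s ≤ 8, and for Im s ≤ 3 with Re
s ≤ -1, Im ψ is too large. In the remaining box Re ψ is too small.

The last three cases need ξ'/ξ to be numerically small, that is, a bound for a sum over zeros. By
the functional equation ξ(1/2+z) is an entire function `xiSq` of v = z², of growth below exp(ε|v|)
on suitable discs. Such a function is controlled by its zeros. In place of an infinite Hadamard
product, `HasSmallGrowth.exists_zeros_approx` divides out the zeros in a large disc and bounds the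
logarithm of the cofactor by Borel–Carathéodory, so that only finite sums occur.

The values ξ(1), ξ(2), ξ(4), ξ(6) are explicit. ξ(6) yields a first zero-free disc for `xiSq`.
Comparing log ξ at 1, 2, 4 then bounds sums of positive terms over the zeros a; these force Re a <
-145 and a total of at most 0.0325 for 1/(-Re a - 64) (`IsXiApprox.sum_inv_le`).

The digamma bounds come from Euler's limit formula (`tendsto_digamma`), a midpoint-rule comparison
with the logarithm, and the cotangent series. -/

/-! ### Dividing out the zeros of an entire function in a disc. -/

/-- An entire function with a zero at `a ≠ 0` is divisible by `1 - v / a`. -/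
lemma Differentiable.exists_eq_one_sub_div_mul {K : ℂ → ℂ} (hK : Differentiable ℂ K) {a : ℂ}
    (ha : a ≠ 0) (h0 : K a = 0) :
    ∃ G : ℂ → ℂ, Differentiable ℂ G ∧ ∀ v, K v = (1 - v / a) * G v := by
  refine ⟨fun v ↦ -a * dslope K a v, ?_, fun v ↦ ?_⟩
  · have : DifferentiableOn ℂ (dslope K a) Set.univ :=
      (Complex.differentiableOn_dslope Filter.univ_mem).2 hK.differentiableOn
    exact (differentiableOn_univ.1 this).const_mul _
  · have h := sub_smul_dslope K a v
    rw [h0, sub_zero, smul_eq_mul] at h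
    rw [← h]
    field_simp
    ring

/-- The product of the elementary factors `1 - v / a` over a finite multiset. -/
noncomputable def zeroProd (S : Multiset ℂ) (v : ℂ) : ℂ := (S.map fun a ↦ 1 - v / a).prod

lemma zeroProd_cons (a : ℂ) (S : Multiset ℂ) (v : ℂ) :
    zeroProd (a ::ₘ S) v = (1 - v / a) * zeroProd S v := by simp [zeroProd]

lemma zeroProd_zero_right (S : Multiset ℂ) : zeroProd S 0 = 1 := by
  induction S using Multiset.induction with
  | empty => simp [zeroProd]
  | cons a S ih => simp [zeroProd_cons, ih]

lemma differentiable_zeroProd (S : Multiset ℂ) : Differentiable ℂ (zeroProd S) := by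
  induction S using Multiset.induction with
  | empty =>
    have : zeroProd 0 = fun _ ↦ 1 := by ext; simp [zeroProd]
    rw [this]; fun_prop
  | cons a S ih =>
    have : zeroProd (a ::ₘ S) = fun v ↦ (1 - v / a) * zeroProd S v := by
      ext v; exact zeroProd_cons a S v
    rw [this]; fun_prop

lemma zeroProd_eq_zero_iff {S : Multiset ℂ} (hS : ∀ a ∈ S, a ≠ 0) {v : ℂ} :
    zeroProd S v = 0 ↔ v ∈ S := by
  rw [zeroProd, Multiset.prod_eq_zero_iff, Multiset.mem_map]
  constructor
  · rintro ⟨a, ha, h⟩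
    have := hS a ha
    have hv : v = a := by field_simp at h; linear_combination -h
    rwa [hv]
  · intro hv
    exact ⟨v, hv, by simp [hS v hv]⟩

/-- On the circle of radius 3R each quotient v/a has modulus at least 3, so each factor has modulus
at least 2. This gain both bounds the number of zeros and keeps the cofactor no larger than the
function. -/
lemma two_pow_card_le_norm_zeroProd {S : Multiset ℂ} {R : ℝ}
    (hS : ∀ a ∈ S, a ≠ 0 ∧ ‖a‖ ≤ R) {v : ℂ} (hv : ‖v‖ = 3 * R) :
    2 ^ Multiset.card S ≤ ‖zeroProd S v‖ := by
  induction S using Multiset.induction with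
  | empty => simp [zeroProd]
  | cons a S ih =>
    rw [zeroProd_cons, norm_mul, Multiset.card_cons, pow_succ, mul_comm]
    have ha := hS a (by simp)
    have h1 : 2 ≤ ‖1 - v / a‖ := by
      have h2 : ‖v / a‖ - ‖(1 : ℂ)‖ ≤ ‖v / a - 1‖ := norm_sub_norm_le _ _
      rw [norm_sub_rev] at h2
      have h3 : 3 ≤ ‖v / a‖ := by
        rw [norm_div, hv, le_div_iff₀ (norm_pos_iff.2 ha.1)]
        linarith [ha.2]
      simp only [norm_one] at h2
      linarith
    exact mul_le_mul h1 (ih fun b hb ↦ hS b (by simp [hb])) (by positivity) (by positivity)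

lemma log_norm_zeroProd {S : Multiset ℂ} (hS : ∀ a ∈ S, a ≠ 0) {v : ℂ} (hv : zeroProd S v ≠ 0) :
    Real.log ‖zeroProd S v‖ = (S.map fun a ↦ Real.log ‖v - a‖ - Real.log ‖a‖).sum := by
  induction S using Multiset.induction with
  | empty => simp [zeroProd]
  | cons a S ih =>
    rw [zeroProd_cons] at hv ⊢
    have h := mul_ne_zero_iff.1 hv
    have ha := hS a (by simp)
    rw [norm_mul, Real.log_mul (norm_ne_zero_iff.2 h.1) (norm_ne_zero_iff.2 h.2),
      ih (fun b hb ↦ hS b (by simp [hb])) h.2, Multiset.map_cons, Multiset.sum_cons]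
    congr 1
    have : 1 - v / a = -((v - a) / a) := by field_simp; ring
    rw [this] at h ⊢
    have h2 : v - a ≠ 0 := by
      intro h3; simp [h3] at h
    rw [norm_neg, norm_div, Real.log_div (norm_ne_zero_iff.2 h2) (norm_ne_zero_iff.2 ha)]

lemma logDeriv_zeroProd {S : Multiset ℂ} (hS : ∀ a ∈ S, a ≠ 0) {v : ℂ} (hv : zeroProd S v ≠ 0) :
    logDeriv (zeroProd S) v = (S.map fun a ↦ 1 / (v - a)).sum := by
  induction S using Multiset.induction with
  | empty =>
    have : zeroProd 0 = fun _ ↦ 1 := by ext; simp [zeroProd]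
    simp [this, logDeriv_apply]
  | cons a S ih =>
    have hfun : zeroProd (a ::ₘ S) = fun v ↦ (1 - v / a) * zeroProd S v := by
      ext v; exact zeroProd_cons a S v
    rw [zeroProd_cons] at hv
    have h := mul_ne_zero_iff.1 hv
    have ha := hS a (by simp)
    rw [hfun, logDeriv_mul v h.1 h.2 (by fun_prop) (differentiable_zeroProd S v),
      ih (fun b hb ↦ hS b (by simp [hb])) h.2, Multiset.map_cons, Multiset.sum_cons]
    congr 1
    have hd : HasDerivAt (fun v : ℂ ↦ 1 - v / a) (-(1 / a)) v := by
      simpa using ((hasDerivAt_id v).div_const a).const_sub 1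
    rw [logDeriv_apply, hd.deriv]
    have h2 : v - a ≠ 0 := by
      intro h3
      apply h.1
      rw [sub_eq_zero.1 h3]; simp [ha]
    have h4 : 1 - v / a = (a - v) / a := by field_simp
    have h5 : a - v ≠ 0 := fun h ↦ h2 (by linear_combination -h)
    rw [h4]
    field_simp
    ring

/-- Maximum modulus bound for the cofactor after dividing out zeros in a disc. -/
lemma norm_cofactor_le {F K : ℂ → ℂ} {S : Multiset ℂ} {R M : ℝ} (hR : 0 < R)
    (hS : ∀ a ∈ S, a ≠ 0 ∧ ‖a‖ ≤ R) (hK : Differentiable ℂ K)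
    (hF : ∀ v, F v = zeroProd S v * K v) (hM : ∀ v, ‖v‖ = 3 * R → ‖F v‖ ≤ M)
    {v : ℂ} (hv : ‖v‖ ≤ 3 * R) : ‖K v‖ ≤ M / 2 ^ Multiset.card S := by
  have hfr : ∀ w ∈ frontier (ball (0 : ℂ) (3 * R)), ‖K w‖ ≤ M / 2 ^ Multiset.card S := by
    intro w hw
    rw [frontier_ball _ (by positivity), mem_sphere_zero_iff_norm] at hw
    have h1 := two_pow_card_le_norm_zeroProd hS hw
    have h2 := hM w hw
    rw [hF, norm_mul] at h2
    rw [le_div_iff₀ (by positivity), mul_comm]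
    exact (mul_le_mul_of_nonneg_right h1 (norm_nonneg _)).trans h2
  refine Complex.norm_le_of_forall_mem_frontier_norm_le isBounded_ball hK.diffContOnCl hfr ?_
  rw [closure_ball _ (by positivity)]
  simpa using hv

/-- The zeros of an entire function in a closed disc can be divided out. -/
lemma exists_zeroProd_mul {F : ℂ → ℂ} (hF : Differentiable ℂ F) (h0 : F 0 ≠ 0) {R : ℝ}
    (hR : 0 < R) :
    ∃ (S : Multiset ℂ) (K : ℂ → ℂ), (∀ a ∈ S, a ≠ 0 ∧ ‖a‖ ≤ R) ∧ Differentiable ℂ K ∧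
      (∀ v, F v = zeroProd S v * K v) ∧ ∀ v, ‖v‖ ≤ R → K v ≠ 0 := by
  -- If zeros could be removed forever, the cofactor after n steps would still equal F 0 at the
  -- origin but be at most M/2^n there.
  by_contra! hcon
  have hn : ∀ n : ℕ, ∃ (S : Multiset ℂ) (K : ℂ → ℂ), Multiset.card S = n ∧
      (∀ a ∈ S, a ≠ 0 ∧ ‖a‖ ≤ R) ∧ Differentiable ℂ K ∧ ∀ v, F v = zeroProd S v * K v := by
    intro n
    induction n with
    | zero => exact ⟨0, F, rfl, by simp, hF, by simp [zeroProd]⟩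
    | succ n ih =>
      obtain ⟨S, K, hc, hS, hK, hFK⟩ := ih
      obtain ⟨a, haR, ha⟩ := hcon S K hS hK hFK
      have ha0 : a ≠ 0 := by
        rintro rfl
        exact h0 (by rw [hFK, ha, mul_zero])
      obtain ⟨G, hG, hKG⟩ := hK.exists_eq_one_sub_div_mul ha0 ha
      refine ⟨a ::ₘ S, G, by simp [hc], ?_, hG, fun v ↦ ?_⟩
      · intro b hb
        rcases Multiset.mem_cons.1 hb with rfl | hb
        · exact ⟨ha0, haR⟩
        · exact hS b hb
      · rw [hFK, hKG, zeroProd_cons]; ring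
  obtain ⟨M, hM⟩ := (isCompact_sphere (0 : ℂ) (3 * R)).exists_bound_of_continuousOn
    hF.continuous.continuousOn
  obtain ⟨n, hn'⟩ := pow_unbounded_of_one_lt (M / ‖F 0‖) one_lt_two
  obtain ⟨S, K, hc, hS, hK, hFK⟩ := hn n
  have h1 := norm_cofactor_le hR hS hK hFK (fun v hv ↦ hM v (by simpa using hv)) (v := 0)
    (by simpa using hR.le)
  have h2 : K 0 = F 0 := by rw [hFK, zeroProd_zero_right, one_mul]
  rw [h2, hc, le_div_iff₀ (by positivity)] at h1
  rw [div_lt_iff₀ (norm_pos_iff.2 h0)] at hn'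
  linarith

/-- A zero-free holomorphic function on a disc has a holomorphic logarithm there. -/
lemma exists_exp_eq_of_ne_zero {K : ℂ → ℂ} (hK : Differentiable ℂ K) {R : ℝ} (hR : 0 < R)
    (h0 : ∀ v, ‖v‖ ≤ R → K v ≠ 0) :
    ∃ g : ℂ → ℂ, g 0 = 0 ∧ (∀ v ∈ ball (0 : ℂ) R, HasDerivAt g (logDeriv K v) v) ∧
      ∀ v ∈ ball (0 : ℂ) R, K v = K 0 * exp (g v) := by
  have hd : DifferentiableOn ℂ (logDeriv K) (ball 0 R) := by
    intro v hv
    have : DifferentiableAt ℂ (deriv K) v := (hK.contDiff (n := 2)).differentiable_deriv_two v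
    exact (this.div (hK v) (h0 v (by simpa using (mem_ball_zero_iff.1 hv).le))).differentiableWithinAt
  obtain ⟨g, hg0, hg⟩ := hd.isExactOn_ball.with_val_at 0 0
  refine ⟨g, hg0, hg, fun v hv ↦ ?_⟩
  have hconst : ∀ w ∈ ball (0 : ℂ) R, HasDerivAt (fun w ↦ K w * exp (-g w)) 0 w := by
    intro w hw
    have h1 := ((hK w).hasDerivAt.mul (hg w hw).neg.cexp)
    convert! h1 using 1
    have := h0 w (by simpa using (mem_ball_zero_iff.1 hw).le)
    rw [logDeriv_apply]
    field_simp
    ring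
  have h2 : K v * exp (-g v) = K 0 * exp (-g 0) :=
    (convex_ball (0 : ℂ) R).is_const_of_fderivWithin_eq_zero (𝕜 := ℂ)
      (fun w hw ↦ (hconst w hw).differentiableAt.differentiableWithinAt)
      (fun w hw ↦ by
        rw [fderivWithin_of_isOpen isOpen_ball hw]
        ext
        simp [(hconst w hw).deriv])
      hv (mem_ball_self hR)
  rw [hg0] at h2
  simp only [neg_zero, exp_zero, mul_one] at h2
  rw [← h2, mul_assoc, ← exp_add]
  simp

/-! ### Finite substitutes for the Hadamard product. -/

/-- Sublinear exponential growth along a sequence of radii. -/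
def HasSmallGrowth (F : ℂ → ℂ) : Prop :=
  ∀ ε > 0, ∀ R₀ : ℝ, ∃ R ≥ R₀, ∀ v, ‖v‖ ≤ R → ‖F v‖ ≤ Real.exp (ε * R)

/-- An entire function of small growth is approximated by the product over its zeros: both its
logarithmic derivative and the logarithm of its modulus are close to finite sums over zeros. -/
theorem HasSmallGrowth.exists_zeros_approx {F : ℂ → ℂ} (hg : HasSmallGrowth F)
    (hF : Differentiable ℂ F) (h0 : F 0 ≠ 0) {ε r : ℝ} (hε : 0 < ε) (hr : 0 < r) :
    ∃ S : Multiset ℂ, (∀ a ∈ S, F a = 0) ∧ (∀ a, ‖a‖ ≤ r → F a = 0 → a ∈ S) ∧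
      (∀ v, ‖v‖ ≤ r → F v ≠ 0 → ‖logDeriv F v - (S.map fun a ↦ 1 / (v - a)).sum‖ ≤ ε) ∧
      ∀ v w, ‖v‖ ≤ r → ‖w‖ ≤ r → F v ≠ 0 → F w ≠ 0 →
        |Real.log ‖F v‖ - Real.log ‖F w‖ -
          (S.map fun a ↦ Real.log ‖v - a‖ - Real.log ‖w - a‖).sum| ≤ ε := by
  -- Below, |g| ≤ 48ηr for |v| ≤ 2r. The first entry makes the Cauchy estimate for g' at most ε; the
  -- second makes each of two values of Re g at most ε/2.
  set η : ℝ := min (ε / 48) (ε / (96 * r)) with hη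
  have hηpos : 0 < η := by positivity
  obtain ⟨R₁, hR₁, hgr⟩ := hg η hηpos
    -- With R₁ = 3R, the first entry gives R ≥ 4r, hence R - 2r ≥ R/2; the second absorbs log ‖F 0‖
    -- into ηR₁.
    (max (12 * r) (|Real.log ‖F 0‖| / η + 1))
  have hR1a : 12 * r ≤ R₁ := (le_max_left _ _).trans hR₁
  have hR1b : |Real.log ‖F 0‖| / η + 1 ≤ R₁ := (le_max_right _ _).trans hR₁
  set R := R₁ / 3 with hRdef
  have hR3 : 3 * R = R₁ := by rw [hRdef]; ring
  have hRr : 4 * r ≤ R := by linarith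
  have hR₁pos : 0 < R₁ := by linarith
  have hR : 0 < R := by linarith
  obtain ⟨S, K, hS, hK, hFK, hK0⟩ := exists_zeroProd_mul hF h0 hR
  have hS0 : ∀ a ∈ S, a ≠ 0 := fun a ha ↦ (hS a ha).1
  obtain ⟨g, hg0, hgd, hgK⟩ := exists_exp_eq_of_ne_zero hK hR hK0
  have hKF : K 0 = F 0 := by rw [hFK, zeroProd_zero_right, one_mul]
  have hKpos : 0 < ‖F 0‖ := norm_pos_iff.2 h0
  have hKb : ∀ v, ‖v‖ ≤ 3 * R → ‖K v‖ ≤ Real.exp (η * R₁) := by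
    intro v hv
    refine (norm_cofactor_le hR hS hK hFK (fun v hv ↦ hgr v (by linarith)) hv).trans ?_
    exact div_le_self (Real.exp_pos _).le (one_le_pow₀ one_le_two)
  have hm : -Real.log ‖F 0‖ ≤ η * R₁ := by
    have h1 : |Real.log ‖F 0‖| ≤ η * (R₁ - 1) := by
      rw [mul_comm, ← div_le_iff₀ hηpos]; linarith
    have h2 := neg_abs_le (Real.log ‖F 0‖)
    nlinarith
  have hre : Set.MapsTo g (ball 0 R) {z | z.re ≤ 2 * η * R₁} := by
    intro v hv
    have hv' := mem_ball_zero_iff.1 hv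
    have h1 := hKb v (by linarith)
    rw [hgK v hv, norm_mul, norm_exp, hKF] at h1
    have h2 := Real.log_le_log (mul_pos hKpos (Real.exp_pos _)) h1
    rw [Real.log_mul hKpos.ne' (Real.exp_pos _).ne', Real.log_exp, Real.log_exp] at h2
    simp only [Set.mem_ofPred_eq]
    linarith
  have hgdiff : DifferentiableOn ℂ g (ball 0 R) := fun v hv ↦
    (hgd v hv).differentiableAt.differentiableWithinAt
  have hgb : ∀ v, ‖v‖ ≤ 2 * r → ‖g v‖ ≤ 48 * η * r := by
    intro v hv
    have hvR : v ∈ ball (0 : ℂ) R := by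
      rw [mem_ball_zero_iff]; linarith
    refine (borelCaratheodory_zero (mul_pos (by positivity) hR₁pos) hgdiff hre hR hvR hg0).trans ?_
    rw [div_le_iff₀ (by linarith)]
    have : R₁ = 3 * R := hR3.symm
    rw [this]
    have h1 : 0 ≤ ‖v‖ := norm_nonneg v
    have h2 : R / 2 ≤ R - ‖v‖ := by linarith
    calc 2 * (2 * η * (3 * R)) * ‖v‖ ≤ 2 * (2 * η * (3 * R)) * (2 * r) := by gcongr
      _ = 48 * η * r * (R / 2) := by ring
      _ ≤ 48 * η * r * (R - ‖v‖) := by gcongr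
  refine ⟨S, fun a ha ↦ ?_, fun a ha h ↦ ?_, fun v hv hFv ↦ ?_, fun v w hv hw hFv hFw ↦ ?_⟩
  · rw [hFK, (zeroProd_eq_zero_iff hS0).2 ha, zero_mul]
  · rw [hFK, mul_eq_zero] at h
    exact (zeroProd_eq_zero_iff hS0).1 (h.resolve_right (hK0 a (by linarith)))
  · have hvR : v ∈ ball (0 : ℂ) R := by rw [mem_ball_zero_iff]; linarith
    have hne : zeroProd S v ≠ 0 ∧ K v ≠ 0 := by
      rw [hFK] at hFv; exact mul_ne_zero_iff.1 hFv
    have hFfun : F = fun v ↦ zeroProd S v * K v := funext hFK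
    rw [hFfun, logDeriv_mul v hne.1 hne.2 (differentiable_zeroProd S v) (hK v),
      logDeriv_zeroProd hS0 hne.1, add_sub_cancel_left, ← (hgd v hvR).deriv]
    have h1 : ‖deriv g v‖ ≤ 48 * η * r / r := by
      refine norm_deriv_le_of_forall_mem_sphere_norm_le hr ?_ fun z hz ↦ hgb z ?_
      · refine (hgdiff.mono fun z hz ↦ ?_).diffContOnCl
        rw [closure_ball _ hr.ne'] at hz
        have := norm_sub_norm_le z v
        rw [mem_closedBall, dist_eq_norm] at hz
        rw [mem_ball_zero_iff]; linarith
      · have := norm_sub_norm_le z v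
        rw [mem_sphere, dist_eq_norm] at hz
        linarith
    refine h1.trans ?_
    rw [mul_div_assoc, div_self hr.ne', mul_one]
    have : η ≤ ε / 48 := min_le_left _ _
    linarith
  · have key : ∀ v, ‖v‖ ≤ r → F v ≠ 0 → Real.log ‖F v‖ =
        (S.map fun a ↦ Real.log ‖v - a‖ - Real.log ‖a‖).sum + Real.log ‖F 0‖ + (g v).re := by
      intro v hv hFv
      have hvR : v ∈ ball (0 : ℂ) R := by rw [mem_ball_zero_iff]; linarith
      rw [hFK] at hFv
      have hne := mul_ne_zero_iff.1 hFv
      rw [hFK, norm_mul, Real.log_mul (norm_ne_zero_iff.2 hne.1) (norm_ne_zero_iff.2 hne.2),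
        log_norm_zeroProd hS0 hne.1, hgK v hvR, norm_mul, norm_exp,
        Real.log_mul (by rw [hKF]; exact hKpos.ne') (Real.exp_pos _).ne', Real.log_exp, hKF]
      ring
    have hs : (S.map fun a ↦ Real.log ‖v - a‖ - Real.log ‖w - a‖).sum =
        (S.map fun a ↦ Real.log ‖v - a‖ - Real.log ‖a‖).sum -
        (S.map fun a ↦ Real.log ‖w - a‖ - Real.log ‖a‖).sum := by
      rw [← Multiset.sum_map_sub]
      congr 1
      refine Multiset.map_congr rfl fun a _ ↦ by ring
    rw [key v hv hFv, key w hw hFw, hs]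
    have h1 := (abs_re_le_norm (g v)).trans (hgb v (by linarith))
    have h2 := (abs_re_le_norm (g w)).trans (hgb w (by linarith))
    have h3 : 48 * η * r ≤ ε / 2 := by
      have : η ≤ ε / (96 * r) := min_le_right _ _
      rw [le_div_iff₀ (by positivity)] at this
      linarith
    rw [abs_le] at h1 h2 ⊢
    constructor <;> linarith

/-! ### Domination of the completed zeta function by its real values. -/

-- The theta kernel exceeds its constant term 1. The functional equation turns this into the bound
-- x^(-1/2) for x < 1, so subtracting the singular part leaves a nonnegative function on both sides
-- of 1.
open HurwitzZeta MeasureTheory Set in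
lemma hurwitzEvenFEPair_f_modif_nonneg {x : ℝ} (hx : 0 < x) :
    (hurwitzEvenFEPair 0).f_modif x = (‖(hurwitzEvenFEPair 0).f_modif x‖ : ℝ) := by
  have hk : ∀ t : ℝ, 0 < t → 1 ≤ evenKernel 0 t := by
    intro t ht
    have h := hasSum_int_evenKernel₀ 0 ht
    have h1 : 0 ≤ evenKernel ((0 : ℝ) : UnitAddCircle) t - if ((0 : ℝ) : UnitAddCircle) = 0 then 1 else 0 :=
      h.nonneg fun n ↦ by split_ifs <;> positivity
    simp only [AddCircle.coe_zero, if_true] at h1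
    linarith
  have main : ∃ y : ℝ, 0 ≤ y ∧ (hurwitzEvenFEPair 0).f_modif x = y := by
    rcases lt_trichotomy x 1 with h | h | h
    · refine ⟨evenKernel 0 x - x ^ (-(1 / 2 : ℝ)), ?_, ?_⟩
      · have h1 := evenKernel_functional_equation 0 x
        rw [h1, ← evenKernel_eq_cosKernel_of_zero, Real.rpow_neg hx.le, one_div]
        have h2 := hk (1 / x) (by positivity)
        have h3 : 0 < (x ^ (1 / 2 : ℝ))⁻¹ := by positivity
        nlinarith
      · simp [WeakFEPair.f_modif, hurwitzEvenFEPair, hx, h, not_lt.2 h.le]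
    · subst h
      exact ⟨0, le_rfl, by simp [WeakFEPair.f_modif]⟩
    · refine ⟨evenKernel 0 x - 1, by linarith [hk x hx], ?_⟩
      simp [WeakFEPair.f_modif, hurwitzEvenFEPair, h, not_lt.2 h.le]
  obtain ⟨y, hy, h⟩ := main
  rw [h, norm_real, Real.norm_of_nonneg hy]

open HurwitzZeta MeasureTheory Set in
/-- The entire completed zeta function is dominated on vertical strips by its real values. -/
lemma norm_completedRiemannZeta₀_le {w : ℂ} {r : ℝ} (hw : |w.re| ≤ r) :
    ‖completedRiemannZeta₀ (1 / 2 + w)‖ ≤ (completedRiemannZeta₀ (1 / 2 + r)).re := by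
  set P := hurwitzEvenFEPair 0 with hP
  set h : ℝ → ℝ := fun t ↦ ‖P.f_modif t‖ with hh
  have hconv : ∀ s : ℂ, MellinConvergent P.f_modif s := fun s ↦
    (P.isStrongFEPair_toStrongFEPair.hasMellin s).1
  have hint : ∀ σ : ℝ, IntegrableOn (fun t ↦ t ^ (σ - 1) * h t) (Ioi 0) := by
    intro σ
    refine IntegrableOn.congr_fun (hconv σ).norm (fun t ht ↦ ?_) measurableSet_Ioi
    simp only [smul_eq_mul, norm_mul, hh]
    rw [norm_cpow_eq_rpow_re_of_pos ht]
    simp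
  have hreal : ∀ x : ℝ, completedRiemannZeta₀ (1 / 2 + x) =
      ((∫ t in Ioi (0 : ℝ), t ^ ((1 / 2 + x) / 2 - 1) * h t) / 2 : ℝ) := by
    intro x
    rw [completedRiemannZeta₀, completedHurwitzZetaEven₀, WeakFEPair.Λ₀, mellin]
    push_cast
    congr 1
    rw [← integral_complex_ofReal]
    refine setIntegral_congr_fun measurableSet_Ioi fun t ht ↦ ?_
    simp only [smul_eq_mul]
    rw [hurwitzEvenFEPair_f_modif_nonneg ht, ofReal_mul, ofReal_cpow (le_of_lt ht)]
    push_cast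
    rfl
  have hnorm : ‖completedRiemannZeta₀ (1 / 2 + w)‖ ≤
      (∫ t in Ioi (0 : ℝ), t ^ ((1 / 2 + w.re) / 2 - 1) * h t) / 2 := by
    rw [completedRiemannZeta₀, completedHurwitzZetaEven₀, WeakFEPair.Λ₀, mellin, norm_div]
    simp only [RCLike.norm_ofNat]
    gcongr
    refine (norm_integral_le_integral_norm _).trans (le_of_eq ?_)
    refine setIntegral_congr_fun measurableSet_Ioi fun t ht ↦ ?_
    simp only [smul_eq_mul, norm_mul, hh]
    rw [norm_cpow_eq_rpow_re_of_pos ht]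
    simp [hP]
  refine hnorm.trans ?_
  have hsymm : (∫ t in Ioi (0 : ℝ), t ^ ((1 / 2 + -r) / 2 - 1) * h t) =
      ∫ t in Ioi (0 : ℝ), t ^ ((1 / 2 + r) / 2 - 1) * h t := by
    have h1 := completedRiemannZeta₀_one_sub (1 / 2 + r)
    have h2 : (1 : ℂ) - (1 / 2 + r) = 1 / 2 + (-r : ℝ) := by push_cast; ring
    rw [h2, hreal, hreal] at h1
    have := ofReal_injective h1
    linarith
  rw [hreal, ofReal_re]
  gcongr ?_ / 2
  rcases eq_or_lt_of_le ((abs_nonneg _).trans hw) with hr | hr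
  · have : w.re = r := by rw [← hr] at hw ⊢; exact abs_eq_zero.1 (le_antisymm hw (abs_nonneg _))
    rw [this]
  set x := w.re
  obtain ⟨hx1, hx2⟩ := abs_le.1 hw
  -- Weights expressing x as a convex combination of r and -r. Weighted AM-GM bounds the power of t
  -- by those at the two endpoints, whose integrals agree by the functional equation.
  set p := (r + x) / (2 * r) with hp
  set q := (r - x) / (2 * r) with hq
  have hp0 : 0 ≤ p := div_nonneg (by linarith) (by linarith)
  have hq0 : 0 ≤ q := div_nonneg (by linarith) (by linarith)
  have hpq : p + q = 1 := by rw [hp, hq]; field_simp; ring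
  have hpx : p * r - q * r = x := by rw [hp, hq]; field_simp; ring
  calc (∫ t in Ioi (0 : ℝ), t ^ ((1 / 2 + x) / 2 - 1) * h t)
      ≤ ∫ t in Ioi (0 : ℝ), (p * (t ^ ((1 / 2 + r) / 2 - 1) * h t) +
          q * (t ^ ((1 / 2 + -r) / 2 - 1) * h t)) := by
        refine setIntegral_mono_on (hint _) (((hint _).const_mul p).add ((hint _).const_mul q))
          measurableSet_Ioi fun t ht ↦ ?_
        have ht : 0 < t := ht
        have h1 := Real.geom_mean_le_arith_mean2_weighted hp0 hq0
          (Real.rpow_nonneg ht.le ((1 / 2 + r) / 2 - 1))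
          (Real.rpow_nonneg ht.le ((1 / 2 + -r) / 2 - 1)) hpq
        rw [← Real.rpow_mul ht.le, ← Real.rpow_mul ht.le, ← Real.rpow_add ht] at h1
        have h2 : ((1 / 2 + r) / 2 - 1) * p + ((1 / 2 + -r) / 2 - 1) * q =
            (1 / 2 + x) / 2 - 1 := by
          linear_combination (-3 / 4) * hpq + hpx / 2
        rw [h2] at h1
        have h3 : 0 ≤ h t := norm_nonneg _
        nlinarith
    _ = ∫ t in Ioi (0 : ℝ), t ^ ((1 / 2 + r) / 2 - 1) * h t := by
        rw [integral_add ((hint _).const_mul p) ((hint _).const_mul q), integral_const_mul,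
          integral_const_mul, hsymm, ← add_mul, hpq, one_mul]

/-! ### The function ξ: non-vanishing and special values. -/

/-- Riemann's `ξ` function, normalised by `ξ 0 = 1 / 2`. -/
noncomputable def riemannXi (s : ℂ) : ℂ := 1 / 2 + s * (s - 1) / 2 * completedRiemannZeta₀ s

lemma differentiable_riemannXi : Differentiable ℂ riemannXi := by
  have := differentiable_completedZeta₀
  unfold riemannXi
  fun_prop

lemma riemannXi_one_sub (s : ℂ) : riemannXi (1 - s) = riemannXi s := by
  rw [riemannXi, riemannXi, completedRiemannZeta₀_one_sub]; ring

lemma riemannXi_eq_completed {s : ℂ} (h0 : s ≠ 0) (h1 : s ≠ 1) :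
    riemannXi s = s * (s - 1) / 2 * completedRiemannZeta s := by
  rw [riemannXi, completedRiemannZeta_eq]
  have h2 : 1 - s ≠ 0 := sub_ne_zero.2 h1.symm
  field_simp
  ring

lemma riemannXi_eq {s : ℂ} (h0 : s ≠ 0) (h1 : s ≠ 1) (hΓ : Gammaℝ s ≠ 0) :
    riemannXi s = s * (s - 1) / 2 * (Gammaℝ s * riemannZeta s) := by
  rw [riemannXi_eq_completed h0 h1, riemannZeta_def_of_ne_zero h0, mul_div_cancel₀ _ hΓ]

lemma riemannXi_ne_zero_of_one_le_re {s : ℂ} (hs : 1 ≤ s.re) : riemannXi s ≠ 0 := by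
  rcases eq_or_ne s 1 with rfl | h1
  · simp [riemannXi]
  have h0 : s ≠ 0 := by rintro rfl; norm_num at hs
  have hΓ : Gammaℝ s ≠ 0 := Gammaℝ_ne_zero_of_re_pos (by linarith)
  rw [riemannXi_eq h0 h1 hΓ]
  have := riemannZeta_ne_zero_of_one_le_re hs
  have := sub_ne_zero.2 h1
  simp [*]

lemma riemannXi_ne_zero_of_re_nonpos {s : ℂ} (hs : s.re ≤ 0) : riemannXi s ≠ 0 := by
  rw [← riemannXi_one_sub]
  exact riemannXi_ne_zero_of_one_le_re (by simpa using hs)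

lemma riemannXi_two_mul_nat {n : ℕ} (hn : n ≠ 0) :
    riemannXi (2 * n) = n * (2 * n - 1) * ((n - 1).factorial / Real.pi ^ n) * riemannZeta (2 * n) := by
  have hn1 : 1 ≤ n := Nat.one_le_iff_ne_zero.2 hn
  have hnc : (n : ℂ) ≠ 0 := Nat.cast_ne_zero.2 hn
  have h1 : (2 * n : ℂ) ≠ 1 := by
    norm_cast; omega
  have hΓ : Gammaℝ (2 * n : ℂ) = (n - 1).factorial / Real.pi ^ n := by
    rw [Gammaℝ_def]
    have e1 : -(2 * n : ℂ) / 2 = -(n : ℂ) := by ring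
    have e2 : (2 * n : ℂ) / 2 = ((n - 1 : ℕ) : ℂ) + 1 := by
      rw [Nat.cast_sub hn1]; push_cast; ring
    rw [e1, e2, Gamma_nat_eq_factorial, cpow_neg, cpow_natCast]
    ring
  rw [riemannXi_eq (by simpa using hn) h1, hΓ]
  · ring
  · exact Gammaℝ_ne_zero_of_re_pos (by simpa using Nat.pos_of_ne_zero hn)

lemma riemannXi_one : riemannXi 1 = 1 / 2 := by simp [riemannXi]

lemma riemannXi_two : riemannXi 2 = (Real.pi / 6 : ℝ) := by
  have h := riemannXi_two_mul_nat one_ne_zero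
  have : (Real.pi : ℂ) ≠ 0 := ofReal_ne_zero.2 Real.pi_ne_zero
  norm_num [riemannZeta_two] at h ⊢
  rw [h]; field_simp

lemma riemannXi_four : riemannXi 4 = (Real.pi ^ 2 / 15 : ℝ) := by
  have h := riemannXi_two_mul_nat two_ne_zero
  have : (Real.pi : ℂ) ≠ 0 := ofReal_ne_zero.2 Real.pi_ne_zero
  norm_num [riemannZeta_four] at h ⊢
  rw [h]; field_simp; norm_num

lemma bernoulli_six : bernoulli 6 = 1 / 42 := by
  rw [bernoulli_eq_bernoulli'_of_ne_one (by norm_num)]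
  have h5 : bernoulli' 5 = 0 := bernoulli'_eq_zero_of_odd (by decide) (by norm_num)
  rw [bernoulli'_def]
  norm_num [Finset.sum_range_succ, bernoulli'_four, h5, Nat.choose]

lemma riemannXi_six : riemannXi 6 = (2 * Real.pi ^ 3 / 63 : ℝ) := by
  have h := riemannXi_two_mul_nat three_ne_zero
  have hz := riemannZeta_two_mul_nat three_ne_zero
  have : (Real.pi : ℂ) ≠ 0 := ofReal_ne_zero.2 Real.pi_ne_zero
  norm_num [bernoulli_six, Nat.factorial] at h hz ⊢
  rw [h, hz]; field_simp; norm_num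

/-- At even integers the Gamma factor is a factorial over a power of π and ζ is at most ζ(2) < 2.
Only log ξ(2n) = O(n log n) matters for the growth of `xiSq`. -/
lemma norm_riemannXi_two_mul_nat_le {n : ℕ} (hn : n ≠ 0) :
    ‖riemannXi (2 * n)‖ ≤ 4 * (n : ℝ) ^ (n + 2) := by
  have hn1 : (1 : ℝ) ≤ n := by exact_mod_cast Nat.one_le_iff_ne_zero.2 hn
  have hz : ‖riemannZeta (2 * n)‖ ≤ 2 := by
    have h1 := zeta_nat_eq_tsum_of_gt_one (k := 2 * n) (by omega)
    push_cast at h1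
    have h2 : ‖riemannZeta (2 * n)‖ ≤ ∑' m : ℕ, 1 / (m : ℝ) ^ 2 := by
      rw [h1]
      refine tsum_of_norm_bounded (Real.summable_one_div_nat_pow.2 one_lt_two).hasSum fun m ↦ ?_
      rcases Nat.eq_zero_or_pos m with rfl | hm
      · simp [hn]
      rw [norm_div, norm_one, norm_pow, norm_natCast]
      have : (1 : ℝ) ≤ m := by exact_mod_cast hm
      exact one_div_le_one_div_of_le (by positivity) (pow_le_pow_right₀ this (by omega))
    rw [hasSum_zeta_two.tsum_eq] at h2
    have := Real.pi_lt_d2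
    have := Real.pi_pos
    nlinarith
  rw [riemannXi_two_mul_nat hn, norm_mul]
  have h3 : ‖(n : ℂ) * (2 * n - 1) * ((n - 1).factorial / Real.pi ^ n)‖ ≤ 2 * (n : ℝ) ^ (n + 2) := by
    have e : (n : ℂ) * (2 * n - 1) * ((n - 1).factorial / Real.pi ^ n) =
        ((n * (2 * n - 1) * ((n - 1).factorial / Real.pi ^ n) : ℝ) : ℂ) := by push_cast; ring
    have hf : ((n - 1).factorial : ℝ) ≤ n ^ n := by
      exact_mod_cast (Nat.factorial_le (Nat.sub_le n 1)).trans (Nat.factorial_le_pow n)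
    have hpi : (1 : ℝ) ≤ Real.pi ^ n := one_le_pow₀ (by linarith [Real.pi_gt_three])
    have h5 : 0 ≤ (n : ℝ) * (2 * n - 1) := mul_nonneg (by linarith) (by linarith)
    rw [e, norm_real, Real.norm_of_nonneg (mul_nonneg h5 (by positivity))]
    calc (n : ℝ) * (2 * n - 1) * ((n - 1).factorial / Real.pi ^ n)
        ≤ (n * (2 * n)) * (n ^ n / 1) := by gcongr; linarith
      _ = 2 * (n : ℝ) ^ (n + 2) := by ring
  calc _ ≤ 2 * (n : ℝ) ^ (n + 2) * 2 := by gcongr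
    _ = _ := by ring

/-! ### The entire function of v = z²: growth and location of zeros. -/

/-- The function `v ↦ ξ (1 / 2 + √v)`, which is entire because `ξ` is symmetric about `1 / 2`. -/
noncomputable def xiSq (v : ℂ) : ℂ := riemannXi (1 / 2 + v ^ ((2 : ℕ) : ℂ)⁻¹)

lemma xiSq_sq (z : ℂ) : xiSq (z ^ 2) = riemannXi (1 / 2 + z) := by
  have h : ((z ^ 2) ^ ((2 : ℕ) : ℂ)⁻¹) ^ 2 = z ^ 2 := cpow_nat_inv_pow _ two_ne_zero
  rw [xiSq]
  rcases sq_eq_sq_iff_eq_or_eq_neg.1 h with h | h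
  · rw [h]
  · rw [h, ← riemannXi_one_sub]
    congr 1
    ring

lemma exists_sq_eq (v : ℂ) : ∃ z : ℂ, z ^ 2 = v := ⟨_, cpow_nat_inv_pow v two_ne_zero⟩

lemma differentiable_xiSq : Differentiable ℂ xiSq := by
  have hne : ∀ v : ℂ, v ≠ 0 → DifferentiableAt ℂ xiSq v := by
    intro v hv
    obtain ⟨w, hw⟩ := exists_sq_eq v
    -- Either square root may be used, so the branch is rotated to have its cut away from v: the
    -- principal root is evaluated near 1.
    have heq : xiSq = fun u ↦ riemannXi (1 / 2 + w * (u / v) ^ ((2 : ℕ) : ℂ)⁻¹) := by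
      ext u
      rw [← xiSq_sq, mul_pow, cpow_nat_inv_pow _ two_ne_zero, hw, mul_div_cancel₀ _ hv]
    rw [heq]
    have h1 : DifferentiableAt ℂ (fun u : ℂ ↦ (u / v) ^ ((2 : ℕ) : ℂ)⁻¹) v := by
      refine DifferentiableAt.cpow_const (by fun_prop) ?_
      rw [div_self hv]
      exact one_mem_slitPlane
    exact (differentiable_riemannXi _).comp v ((h1.const_mul w).const_add _)
  intro v
  rcases eq_or_ne v 0 with rfl | hv
  · refine (analyticAt_of_differentiable_on_punctured_nhds_of_continuousAt ?_ ?_).differentiableAt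
    · filter_upwards [self_mem_nhdsWithin] with u hu using hne u hu
    · have h1 : ContinuousAt (fun u : ℂ ↦ u ^ ((2 : ℕ) : ℂ)⁻¹) 0 :=
        continuousAt_cpow_const_of_re_pos (by simp) (by norm_num)
      exact (differentiable_riemannXi.continuous.continuousAt).comp (h1.const_add _)
  · exact hne v hv

lemma riemannXi_half_add (z : ℂ) :
    riemannXi (1 / 2 + z) = 1 / 2 + (z ^ 2 - 1 / 4) / 2 * completedRiemannZeta₀ (1 / 2 + z) := by
  rw [riemannXi]; ring

lemma norm_xiSq_sub_half_le {v : ℂ} {r : ℝ} (hr : 0 ≤ r) (hv : ‖v‖ ≤ r ^ 2) :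
    ‖xiSq v - 1 / 2‖ ≤ (r ^ 2 + 1 / 4) / 2 * (completedRiemannZeta₀ (1 / 2 + r)).re := by
  obtain ⟨z, rfl⟩ := exists_sq_eq v
  rw [norm_pow] at hv
  have hz : ‖z‖ ≤ r := by
    have := abs_le_of_sq_le_sq' hv hr; exact this.2
  rw [xiSq_sq, riemannXi_half_add, add_sub_cancel_left, norm_mul, norm_div]
  have h1 : ‖z ^ 2 - 1 / 4‖ ≤ r ^ 2 + 1 / 4 := by
    refine (norm_sub_le _ _).trans ?_
    rw [norm_pow]
    norm_num
    linarith
  simp only [RCLike.norm_ofNat]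
  gcongr
  exact norm_completedRiemannZeta₀_le ((abs_re_le_norm z).trans hz)

lemma re_riemannXi_half_add (r : ℝ) : (riemannXi (1 / 2 + r)).re =
    1 / 2 + (r ^ 2 - 1 / 4) / 2 * (completedRiemannZeta₀ (1 / 2 + r)).re := by
  rw [riemannXi_half_add]
  have : ((r : ℂ) ^ 2 - 1 / 4) / 2 = (((r ^ 2 - 1 / 4) / 2 : ℝ) : ℂ) := by push_cast; ring
  rw [this, add_re, re_ofReal_mul]
  norm_num

lemma hasSmallGrowth_xiSq : HasSmallGrowth xiSq := by
  intro ε hε R₀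
  have h1 : ∀ᶠ n : ℕ in atTop, Real.log n ≤ ε / 6 * n := by
    have := (Real.isLittleO_log_id_atTop.comp_tendsto tendsto_natCast_atTop_atTop).bound
      (show 0 < ε / 6 by positivity)
    filter_upwards [this] with n hn
    simp only [Function.comp_apply, id_eq, Real.norm_eq_abs, Nat.abs_cast] at hn
    exact (le_abs_self _).trans hn
  have h2 : ∀ᶠ n : ℕ in atTop, max (max 1 R₀) (18 / ε) ≤ n :=
    tendsto_natCast_atTop_atTop.eventually_ge_atTop _
  obtain ⟨n, hn1, hn2⟩ := (h1.and h2).exists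
  have hn3 : (1 : ℝ) ≤ n := ((le_max_left _ _).trans (le_max_left _ _)).trans hn2
  have hn4 : R₀ ≤ n := ((le_max_right _ _).trans (le_max_left _ _)).trans hn2
  have hn5 : 18 / ε ≤ n := (le_max_right _ _).trans hn2
  have hn0 : n ≠ 0 := by rintro rfl; norm_num at hn3
  -- Chosen so that 1/2 + r = 2n. The radius r² in the v-plane is of order n², which beats log ξ(2n)
  -- = O(n log n).
  set r : ℝ := 2 * n - 1 / 2 with hr
  have hrn : (n : ℝ) ^ 2 ≤ r ^ 2 := by rw [hr]; nlinarith
  have hr0 : 0 ≤ r := by linarith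
  refine ⟨r ^ 2, by nlinarith, fun v hv ↦ ?_⟩
  have hA := norm_xiSq_sub_half_le hr0 hv
  have hB := re_riemannXi_half_add r
  have hC : (1 / 2 + r : ℂ) = 2 * n := by rw [hr]; push_cast; ring
  have hD := norm_riemannXi_two_mul_nat_le hn0
  have hE := (abs_le.1 (abs_re_le_norm (riemannXi (2 * n)))).2
  rw [hC] at hA hB
  set C := (completedRiemannZeta₀ (2 * n)).re
  have hr1 : 3 / 4 ≤ r ^ 2 := by nlinarith
  have hC0 : 0 ≤ C := by
    have : 0 ≤ (r ^ 2 + 1 / 4) / 2 * C := (norm_nonneg _).trans hA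
    exact nonneg_of_mul_nonneg_right this (by positivity)
  -- Since r² ≥ 3/4, the factor r² + 1/4 is at most twice r² - 1/4, so the distance from 1/2 is at
  -- most twice that of ξ(2n).
  have hF : ‖xiSq v‖ ≤ 10 * (n : ℝ) ^ (n + 2) := by
    have h3 := norm_sub_norm_le (xiSq v) (1 / 2)
    have h4 : ‖(1 / 2 : ℂ)‖ = 1 / 2 := by norm_num
    have h5 : (1 : ℝ) ≤ (n : ℝ) ^ (n + 2) := one_le_pow₀ hn3
    nlinarith
  refine hF.trans ?_
  have hpos : (0 : ℝ) < n := by linarith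
  rw [← Real.log_le_iff_le_exp (by positivity), Real.log_mul (by norm_num) (by positivity),
    Real.log_pow]
  have h10 : Real.log 10 ≤ 9 := by
    have := Real.log_le_sub_one_of_pos (show (0 : ℝ) < 10 by norm_num); linarith
  have h6 : ((n + 2 : ℕ) : ℝ) * Real.log n ≤ 3 * n * (ε / 6 * n) := by
    push_cast
    have := Real.log_nonneg hn3
    gcongr
    linarith
  have h7 : 18 ≤ n * ε := by rwa [div_le_iff₀ hε] at hn5
  nlinarith

/-- Take r = 11/2, so 1/2 + r = 6. On |v| ≤ r² the distance from `xiSq` to 1/2 is at most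
(61/60)(ξ(6) - 1/2), which is below 1/2. -/
lemma norm_gt_of_xiSq_eq_zero {a : ℂ} (ha : xiSq a = 0) : 121 / 4 < ‖a‖ := by
  by_contra! h
  have hA := norm_xiSq_sub_half_le (r := 11 / 2) (by norm_num) (h.trans (by norm_num))
  have hB := re_riemannXi_half_add (11 / 2)
  have hC : (1 / 2 + ((11 / 2 : ℝ) : ℂ)) = 6 := by push_cast; norm_num
  rw [hC] at hA hB
  rw [riemannXi_six, ofReal_re] at hB
  rw [ha] at hA
  norm_num at hA hB
  have h1 := Real.pi_lt_d4
  have h2 : Real.pi ^ 3 < 3.1416 ^ 3 := by gcongr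
  norm_num at h2
  linarith

/-- Zeros of `xiSq` are squares of points in the strip `|re| < 1 / 2` of not too small height. -/
lemma exists_of_xiSq_eq_zero {a : ℂ} (ha : xiSq a = 0) :
    ∃ δ γ : ℝ, δ ^ 2 ≤ 1 / 4 ∧ 0 < γ ∧ 30 < γ ^ 2 ∧ a = (δ + γ * I) ^ 2 := by
  have hn := norm_gt_of_xiSq_eq_zero ha
  obtain ⟨z, rfl⟩ := exists_sq_eq a
  rw [xiSq_sq] at ha
  have h1 : z.re < 1 / 2 := by
    by_contra! h
    refine riemannXi_ne_zero_of_one_le_re ?_ ha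
    simp; linarith
  have h2 : -(1 / 2) < z.re := by
    by_contra! h
    refine riemannXi_ne_zero_of_re_nonpos ?_ ha
    simp; linarith
  have h3 : z.re ^ 2 ≤ 1 / 4 := by nlinarith
  rw [norm_pow, ← normSq_eq_norm_sq, normSq_apply] at hn
  have h4 : 30 < z.im ^ 2 := by nlinarith
  rcases lt_trichotomy z.im 0 with h | h | h
  · refine ⟨-z.re, -z.im, by simpa using h3, by linarith, by simpa using h4, ?_⟩
    have : ((-z.re : ℝ) + (-z.im : ℝ) * I : ℂ) = -z := by
      apply Complex.ext <;> simp
    rw [this, neg_sq]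
  · rw [h] at h4; norm_num at h4
  · exact ⟨z.re, z.im, h3, h, h4, by rw [re_add_im]⟩

lemma xiSq_ofReal_sq (x : ℝ) : xiSq ((x ^ 2 : ℝ) : ℂ) = riemannXi (1 / 2 + x) := by
  rw [ofReal_pow, xiSq_sq]

lemma xiSq_one_quarter : xiSq ((1 / 4 : ℝ) : ℂ) = (1 / 2 : ℝ) := by
  have := xiSq_ofReal_sq (1 / 2)
  norm_num at this ⊢
  rw [this, riemannXi_one]

lemma xiSq_nine_quarters : xiSq ((9 / 4 : ℝ) : ℂ) = (Real.pi / 6 : ℝ) := by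
  have := xiSq_ofReal_sq (3 / 2)
  norm_num at this ⊢
  have h := riemannXi_two
  norm_num at h
  rw [this, h]

lemma xiSq_forty_nine_quarters : xiSq ((49 / 4 : ℝ) : ℂ) = (Real.pi ^ 2 / 15 : ℝ) := by
  have := xiSq_ofReal_sq (7 / 2)
  norm_num at this ⊢
  have h := riemannXi_four
  norm_num at h
  rw [this, h]

lemma xiSq_zero_ne_zero : xiSq 0 ≠ 0 := fun h ↦ by
  have := norm_gt_of_xiSq_eq_zero h
  norm_num at this

/-! ### Reflection symmetry. -/

open HurwitzZeta MeasureTheory Set ComplexConjugate in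
lemma completedRiemannZeta₀_conj (s : ℂ) :
    completedRiemannZeta₀ (conj s) = conj (completedRiemannZeta₀ s) := by
  rw [completedRiemannZeta₀, completedHurwitzZetaEven₀, completedRiemannZeta₀,
    completedHurwitzZetaEven₀, WeakFEPair.Λ₀, mellin, mellin, map_div₀, ← integral_conj]
  simp only [map_ofNat]
  congr 1
  refine setIntegral_congr_fun measurableSet_Ioi fun t ht ↦ ?_
  have ht : 0 < t := ht
  simp only [smul_eq_mul, map_mul]
  rw [hurwitzEvenFEPair_f_modif_nonneg ht, conj_ofReal]
  congr 1
  have harg : (t : ℂ).arg ≠ Real.pi := by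
    rw [arg_ofReal_of_nonneg ht.le]; exact Real.pi_ne_zero.symm
  have h := cpow_conj (t : ℂ) (s / 2 - 1) harg
  rw [conj_ofReal] at h
  rw [← h, map_sub, map_div₀, map_one, conj_ofNat]

open ComplexConjugate in
lemma riemannXi_conj (s : ℂ) : riemannXi (conj s) = conj (riemannXi s) := by
  simp [riemannXi, completedRiemannZeta₀_conj, conj_ofNat]

open ComplexConjugate in
lemma xiSq_conj (v : ℂ) : xiSq (conj v) = conj (xiSq v) := by
  obtain ⟨z, rfl⟩ := exists_sq_eq v
  rw [map_pow, xiSq_sq, xiSq_sq, ← riemannXi_conj]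
  simp [conj_ofNat]

open ComplexConjugate in
lemma logDeriv_xiSq_conj (v : ℂ) : logDeriv xiSq (conj v) = conj (logDeriv xiSq v) := by
  have h : xiSq = conj ∘ xiSq ∘ conj := by
    ext u
    simp [xiSq_conj]
  have hd : deriv xiSq (conj v) = conj (deriv xiSq v) := by
    conv_lhs => rw [h]
    rw [deriv_conj_conj]
    simp
  rw [logDeriv_apply, logDeriv_apply, xiSq_conj, hd, map_div₀]

/-! ### Contribution of one zero to differences of log |ξ|. -/

lemma Real.log_le_sub_inv_div_two {y : ℝ} (hy : 1 ≤ y) : Real.log y ≤ (y - y⁻¹) / 2 := by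
  rw [← Real.sinh_log (by linarith)]
  exact Real.self_le_sinh_iff.2 (Real.log_nonneg hy)

lemma Real.two_mul_sub_div_add_le_log {A B : ℝ} (hB : 0 < B) (h : B ≤ A) :
    2 * (A - B) / (A + B) ≤ Real.log A - Real.log B := by
  have h1 := Real.le_log_one_add_of_nonneg (x := A / B - 1) (by
    rw [sub_nonneg, le_div_iff₀ hB]; linarith)
  rw [add_sub_cancel, Real.log_div (by linarith) hB.ne'] at h1
  refine le_trans (le_of_eq ?_) h1
  field_simp
  ring

/-- Logarithmic distance from the real point `x` to `a`. -/
noncomputable def logDist (x : ℝ) (a : ℂ) : ℝ := Real.log ‖(x : ℂ) - a‖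

lemma logDist_eq {x : ℝ} {a : ℂ} :
    logDist x a = Real.log ((x - a.re) ^ 2 + a.im ^ 2) / 2 := by
  rw [logDist, Complex.norm_eq_sqrt_sq_add_sq, Real.log_sqrt (by positivity)]
  simp

/-- The geometric constraint satisfied by all zeros of `xiSq`. -/
lemma re_im_of_xiSq_eq_zero {a : ℂ} (ha : xiSq a = 0) :
    a.re ≤ -(119 / 4) ∧ a.im ^ 2 ≤ -a.re + 1 / 4 := by
  obtain ⟨δ, γ, h1, h2, h3, rfl⟩ := exists_of_xiSq_eq_zero ha
  have hre : ((δ + γ * I : ℂ) ^ 2).re = δ ^ 2 - γ ^ 2 := by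
    simp [sq]
  have him : ((δ + γ * I : ℂ) ^ 2).im = 2 * δ * γ := by
    simp [sq]; ring
  rw [hre, him]
  constructor
  · linarith
  · nlinarith [sq_nonneg γ]

lemma logDist_sub_ge {a : ℂ} (h1 : a.re ≤ -(119 / 4)) (h2 : a.im ^ 2 ≤ -a.re + 1 / 4) :
    2 / (-a.re + 9 / 4) ≤ logDist (9 / 4) a - logDist (1 / 4) a := by
  -- 5/4 is the midpoint of 1/4 and 9/4, so the two squared distances are (p ± 1)² + b. The claim
  -- then reduces to b ≤ p - 1, which is the constraint on `a.im`.
  obtain ⟨p, hp⟩ : ∃ p, p = -a.re + 5 / 4 := ⟨_, rfl⟩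
  have hre : a.re = 5 / 4 - p := by linarith
  rw [logDist_eq, logDist_eq, hre]
  rw [hre] at h1 h2
  have hb := sq_nonneg a.im
  set b := a.im ^ 2
  have h := Real.two_mul_sub_div_add_le_log (A := (9 / 4 - (5 / 4 - p)) ^ 2 + b)
    (B := (1 / 4 - (5 / 4 - p)) ^ 2 + b) (by nlinarith) (by nlinarith)
  have h3 : 2 * 2 / (-(5 / 4 - p) + 9 / 4) ≤ 2 * ((9 / 4 - (5 / 4 - p)) ^ 2 + b -
      ((1 / 4 - (5 / 4 - p)) ^ 2 + b)) / ((9 / 4 - (5 / 4 - p)) ^ 2 + b +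
      ((1 / 4 - (5 / 4 - p)) ^ 2 + b)) := by
    rw [div_le_div_iff₀ (by linarith) (by nlinarith)]
    nlinarith
  have h4 : 2 / (-(5 / 4 - p) + 9 / 4) = 2 * 2 / (-(5 / 4 - p) + 9 / 4) / 2 := by ring
  rw [h4]
  linarith

/-- The rational inequality behind `logDistDiff_ge`. There D = p² + 1 + b, and D + 2p, D + 22p + 120
are the squared distances from a to 9/4 and 49/4. -/
lemma second_difference_aux {p D : ℝ} (hp : 31 ≤ p) (hD1 : p ^ 2 + 1 ≤ D) (hD2 : D ≤ p ^ 2 + p) :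
    12 / ((p + 8) * (p + 15)) ≤
      2 * p / D - (p + 6) * (1 / (D + 2 * p) + 1 / (D + 22 * p + 120)) := by
  have hD : 0 < D := by nlinarith
  have hA : 0 < D + 2 * p := by linarith
  have hC : 0 < D + 22 * p + 120 := by linarith
  have hN : 2 * p / D - (p + 6) * (1 / (D + 2 * p) + 1 / (D + 22 * p + 120)) =
      (-12 * D ^ 2 + D * (24 * p ^ 2 - 24 * p - 720) + 88 * p ^ 3 + 480 * p ^ 2) /
        (D * (D + 2 * p) * (D + 22 * p + 120)) := by
    field_simp
    ring
  rw [hN]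
  have hnum : 12 * p ^ 4 + 64 * p ^ 3 - 276 * p ^ 2 - 720 * p ≤
      -12 * D ^ 2 + D * (24 * p ^ 2 - 24 * p - 720) + 88 * p ^ 3 + 480 * p ^ 2 := by
    obtain ⟨u, rfl⟩ : ∃ u, D = p ^ 2 + p - u := ⟨p ^ 2 + p - D, by ring⟩
    have hu0 : 0 ≤ u := by linarith
    have hu1 : u ≤ p - 1 := by linarith
    nlinarith [mul_nonneg hu0 (sub_nonneg.2 hu1), mul_nonneg hu0 (show 0 ≤ p by linarith)]
  have hden : D * (D + 2 * p) * (D + 22 * p + 120) ≤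
      (p ^ 2 + p) * (p ^ 2 + 3 * p) * ((p + 8) * (p + 15)) := by
    have e1 : D + 2 * p ≤ p ^ 2 + 3 * p := by linarith
    have e2 : D + 22 * p + 120 ≤ (p + 8) * (p + 15) := by linarith
    gcongr
  have hpos : 0 < (p + 8) * (p + 15) := by nlinarith
  rw [div_le_div_iff₀ hpos (by positivity)]
  have h5 : 12 * ((p ^ 2 + p) * (p ^ 2 + 3 * p)) ≤
      12 * p ^ 4 + 64 * p ^ 3 - 276 * p ^ 2 - 720 * p := by
    have : 0 ≤ p * (16 * p * (p - 20) + 8 * p - 720) := by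
      apply mul_nonneg <;> nlinarith
    nlinarith
  calc 12 * (D * (D + 2 * p) * (D + 22 * p + 120))
      ≤ 12 * ((p ^ 2 + p) * (p ^ 2 + 3 * p) * ((p + 8) * (p + 15))) := by gcongr
    _ = 12 * ((p ^ 2 + p) * (p ^ 2 + 3 * p)) * ((p + 8) * (p + 15)) := by ring
    _ ≤ _ := by
      apply mul_le_mul_of_nonneg_right (h5.trans hnum) hpos.le

/-- A weighted second difference of `log |x - a|` at `x = 1/4, 9/4, 49/4`. -/
noncomputable def logDistDiff (a : ℂ) : ℝ :=
  5 * (logDist (9 / 4) a - logDist (1 / 4) a) - (logDist (49 / 4) a - logDist (9 / 4) a)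

/-- The gaps between the points are 2 and 10, so the weight 5 cancels the terms of order 1/|a|. What
remains is positive and of order 1/|a|², by concavity of the logarithm. -/
lemma logDistDiff_ge {a : ℂ} (h1 : a.re ≤ -(119 / 4)) (h2 : a.im ^ 2 ≤ -a.re + 1 / 4) :
    60 / ((-a.re + 37 / 4) * (-a.re + 65 / 4)) ≤ logDistDiff a := by
  obtain ⟨p, hp⟩ : ∃ p, p = -a.re + 5 / 4 := ⟨_, rfl⟩
  have hre : a.re = 5 / 4 - p := by linarith
  rw [logDistDiff, logDist_eq, logDist_eq, logDist_eq, hre]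
  rw [hre] at h1 h2
  have hb := sq_nonneg a.im
  set b := a.im ^ 2
  obtain ⟨D, hD⟩ : ∃ D, D = p ^ 2 + 1 + b := ⟨_, rfl⟩
  have eA : (9 / 4 - (5 / 4 - p)) ^ 2 + b = D + 2 * p := by rw [hD]; ring
  have eB : (1 / 4 - (5 / 4 - p)) ^ 2 + b = D - 2 * p := by rw [hD]; ring
  have eC : (49 / 4 - (5 / 4 - p)) ^ 2 + b = D + 22 * p + 120 := by rw [hD]; ring
  rw [eA, eB, eC]
  have hp31 : 31 ≤ p := by linarith
  have key := second_difference_aux hp31 (D := D) (by linarith) (by linarith)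
  have hDpos : 0 < D := by nlinarith
  have hBpos : 0 < D - 2 * p := by nlinarith
  have hApos : 0 < D + 2 * p := by linarith
  have hCpos : 0 < D + 22 * p + 120 := by linarith
  have l1 := Real.two_mul_sub_div_add_le_log (A := D + 2 * p) (B := D - 2 * p) hBpos (by linarith)
  have l2 := Real.log_le_sub_inv_div_two (y := (D + 22 * p + 120) / (D + 2 * p)) (by
    rw [le_div_iff₀ hApos]; linarith)
  rw [Real.log_div hCpos.ne' hApos.ne'] at l2
  have e1 : 2 * (D + 2 * p - (D - 2 * p)) / (D + 2 * p + (D - 2 * p)) = 2 * (2 * p / D) := by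
    field_simp; ring
  have e2 : ((D + 22 * p + 120) / (D + 2 * p) - ((D + 22 * p + 120) / (D + 2 * p))⁻¹) / 2 =
      10 * ((p + 6) * (1 / (D + 2 * p) + 1 / (D + 22 * p + 120))) := by
    field_simp; ring
  rw [e1] at l1
  rw [e2] at l2
  have e3 : 60 / ((-(5 / 4 - p) + 37 / 4) * (-(5 / 4 - p) + 65 / 4)) =
      5 * (12 / ((p + 8) * (p + 15))) := by
    have : (-(5 / 4 - p) + 37 / 4) * (-(5 / 4 - p) + 65 / 4) = (p + 8) * (p + 15) := by ring
    rw [this]; ring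
  rw [e3]
  linarith

/-! ### Numerical bounds for sums over zeros. -/

/-- A finite multiset of zeros of `xiSq` that approximates `xiSq` on `‖v‖ ≤ r` up to `ε`. -/
structure IsXiApprox (S : Multiset ℂ) (r ε : ℝ) : Prop where
  zero : ∀ a ∈ S, xiSq a = 0
  mem : ∀ a, ‖a‖ ≤ r → xiSq a = 0 → a ∈ S
  logDeriv : ∀ v, ‖v‖ ≤ r → xiSq v ≠ 0 →
    ‖logDeriv xiSq v - (S.map fun a ↦ 1 / (v - a)).sum‖ ≤ ε
  log : ∀ v w, ‖v‖ ≤ r → ‖w‖ ≤ r → xiSq v ≠ 0 → xiSq w ≠ 0 →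
    |Real.log ‖xiSq v‖ - Real.log ‖xiSq w‖ -
      (S.map fun a ↦ Real.log ‖v - a‖ - Real.log ‖w - a‖).sum| ≤ ε

lemma exists_isXiApprox {r ε : ℝ} (hr : 0 < r) (hε : 0 < ε) : ∃ S, IsXiApprox S r ε := by
  obtain ⟨S, h1, h2, h3, h4⟩ :=
    hasSmallGrowth_xiSq.exists_zeros_approx differentiable_xiSq xiSq_zero_ne_zero hε hr
  exact ⟨S, h1, h2, h3, h4⟩

lemma IsXiApprox.sum_logDist {S : Multiset ℂ} {r ε : ℝ} (h : IsXiApprox S r ε) {x y p q : ℝ}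
    (hx : |x| ≤ r) (hy : |y| ≤ r) (hp : 0 < p) (hq : 0 < q) (hxp : xiSq x = p) (hyq : xiSq y = q) :
    |Real.log p - Real.log q - (S.map fun a ↦ logDist x a - logDist y a).sum| ≤ ε := by
  have := h.log x y (by simpa using hx) (by simpa using hy)
    (by rw [hxp]; exact_mod_cast hp.ne') (by rw [hyq]; exact_mod_cast hq.ne')
  rwa [hxp, hyq, norm_real, norm_real, Real.norm_of_nonneg hp.le, Real.norm_of_nonneg hq.le] at this

lemma IsXiApprox.sum_first_le {S : Multiset ℂ} {r ε : ℝ} (h : IsXiApprox S r ε) (hr : 13 ≤ r) :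
    (S.map fun a ↦ logDist (9 / 4) a - logDist (1 / 4) a).sum ≤ 0.0472 + ε := by
  have hpi := Real.pi_pos
  have h1 := h.sum_logDist (x := 9 / 4) (y := 1 / 4) (by rw [abs_of_pos] <;> linarith)
    (by rw [abs_of_pos] <;> linarith) (by positivity) (by norm_num)
    xiSq_nine_quarters xiSq_one_quarter
  have h2 : Real.log (Real.pi / 6) - Real.log (1 / 2) ≤ 0.0472 := by
    rw [← Real.log_div (by positivity) (by norm_num)]
    refine (Real.log_le_sub_one_of_pos (by positivity)).trans ?_
    have := Real.pi_lt_d4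
    linarith
  have := (abs_le.1 h1).1
  linarith

/-- By ξ(1) = 1/2, ξ(2) = π/6 and ξ(4) = π²/15, the weighted second difference of log ξ is
log(5π⁴/486), where 5π⁴/486 is just above 1. -/
lemma IsXiApprox.sum_logDistDiff_le {S : Multiset ℂ} {r ε : ℝ} (h : IsXiApprox S r ε)
    (hr : 13 ≤ r) : (S.map logDistDiff).sum ≤ 0.00217 + 6 * ε := by
  have hpi := Real.pi_pos
  have h1 := h.sum_logDist (x := 9 / 4) (y := 1 / 4) (by rw [abs_of_pos] <;> linarith)
    (by rw [abs_of_pos] <;> linarith) (by positivity) (by norm_num)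
    xiSq_nine_quarters xiSq_one_quarter
  have h2 := h.sum_logDist (x := 49 / 4) (y := 9 / 4) (by rw [abs_of_pos] <;> linarith)
    (by rw [abs_of_pos] <;> linarith) (by positivity) (by positivity)
    xiSq_forty_nine_quarters xiSq_nine_quarters
  have h3 : 5 * (Real.log (Real.pi / 6) - Real.log (1 / 2)) -
      (Real.log (Real.pi ^ 2 / 15) - Real.log (Real.pi / 6)) ≤ 0.00217 := by
    have e : 5 * (Real.log (Real.pi / 6) - Real.log (1 / 2)) -
        (Real.log (Real.pi ^ 2 / 15) - Real.log (Real.pi / 6)) =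
        Real.log (5 * Real.pi ^ 4 / 486) := by
      rw [← Real.log_div (by positivity) (by norm_num),
        ← Real.log_div (by positivity) (by positivity)]
      rw [show (5 : ℝ) * Real.log (Real.pi / 6 / (1 / 2)) =
        ((5 : ℕ) : ℝ) * Real.log (Real.pi / 6 / (1 / 2)) by norm_num, ← Real.log_pow,
        ← Real.log_div (by positivity) (by positivity)]
      congr 1
      field_simp
      norm_num
    rw [e]
    refine (Real.log_le_sub_one_of_pos (by positivity)).trans ?_
    have : Real.pi ^ 4 ≤ 3.1416 ^ 4 := by
      gcongr; exact Real.pi_lt_d4.le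
    norm_num at this ⊢
    linarith
  have e : (S.map logDistDiff).sum =
      5 * (S.map fun a ↦ logDist (9 / 4) a - logDist (1 / 4) a).sum -
      (S.map fun a ↦ logDist (49 / 4) a - logDist (9 / 4) a).sum := by
    rw [← Multiset.sum_map_mul_left, ← Multiset.sum_map_sub]
    rfl
  have h4 := (abs_le.1 h1).1
  have h5 := (abs_le.1 h2).2
  rw [e]
  linarith

/-- All terms `logDistDiff b` are nonnegative, so a single one cannot exceed the total, about
0.0022; a zero with Re a ≥ -145 would contribute at least 0.0024. -/
lemma re_lt_of_xiSq_eq_zero {a : ℂ} (ha : xiSq a = 0) : a.re < -145 := by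
  by_contra! hcon
  obtain ⟨S, hS⟩ := exists_isXiApprox (r := max 13 ‖a‖) (ε := 1 / 100000) (by positivity)
    (by norm_num)
  have h1 := hS.sum_logDistDiff_le (le_max_left _ _)
  have h2 : logDistDiff a ≤ (S.map logDistDiff).sum := by
    refine Multiset.single_le_sum (fun x hx ↦ ?_) _
      (Multiset.mem_map_of_mem _ (hS.mem a (le_max_right _ _) ha))
    obtain ⟨b, hb, rfl⟩ := Multiset.mem_map.1 hx
    obtain ⟨hb1, hb2⟩ := re_im_of_xiSq_eq_zero (hS.zero b hb)
    refine le_trans ?_ (logDistDiff_ge hb1 hb2)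
    have : 0 ≤ (-b.re + 37 / 4) * (-b.re + 65 / 4) := by nlinarith
    positivity
  obtain ⟨ha1, ha2⟩ := re_im_of_xiSq_eq_zero ha
  have h3 := logDistDiff_ge ha1 ha2
  have h4 : (0.0024 : ℝ) ≤ 60 / ((-a.re + 37 / 4) * (-a.re + 65 / 4)) := by
    rw [le_div_iff₀ (by nlinarith)]
    nlinarith
  norm_num at h1 h4
  linarith

/-- The first difference controls 1/|a| to leading order, and four times the second difference pays
for the shift by 64 once Re a < -145. The total is 0.0472/2 + 4 · 0.00217 plus an error. The 64 is
8², from the later restriction to Im z ≤ 8 or |z| ≤ 8. -/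
lemma IsXiApprox.sum_inv_le {S : Multiset ℂ} {r ε : ℝ} (h : IsXiApprox S r ε) (hr : 13 ≤ r)
    (hε : ε ≤ 1 / 1000000) : (S.map fun a ↦ 1 / (-a.re - 64)).sum ≤ 0.0325 := by
  have h1 := h.sum_first_le hr
  have h2 := h.sum_logDistDiff_le hr
  have h3 : (S.map fun a ↦ 1 / (-a.re - 64)).sum ≤
      (S.map fun a ↦ 1 / 2 * (logDist (9 / 4) a - logDist (1 / 4) a) + 4 * logDistDiff a).sum := by
    refine Multiset.sum_map_le_sum_map _ _ fun a ha ↦ ?_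
    have ha0 := h.zero a ha
    have ha3 := re_lt_of_xiSq_eq_zero ha0
    obtain ⟨ha1, ha2⟩ := re_im_of_xiSq_eq_zero ha0
    have h5 := logDist_sub_ge ha1 ha2
    have h6 := logDistDiff_ge ha1 ha2
    refine le_trans ?_ (add_le_add (mul_le_mul_of_nonneg_left h5 (by norm_num))
      (mul_le_mul_of_nonneg_left h6 (by norm_num)))
    obtain ⟨u, hu⟩ : ∃ u, u = -a.re - 145 := ⟨_, rfl⟩
    have hu0 : 0 < u := by linarith
    have hre : a.re = -145 - u := by linarith
    rw [hre]
    have e1 : 1 / (-(-145 - u) - 64) - 1 / 2 * (2 / (-(-145 - u) + 9 / 4)) =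
        (265 / 4) / ((u + 81) * (u + 589 / 4)) := by
      rw [show -(-145 - u) - 64 = u + 81 by ring, show -(-145 - u) + 9 / 4 = u + 589 / 4 by ring]
      have : u + 81 ≠ 0 := by positivity
      have : u + 589 / 4 ≠ 0 := by positivity
      field_simp
      ring
    have e2 : 4 * (60 / ((-(-145 - u) + 37 / 4) * (-(-145 - u) + 65 / 4))) =
        240 / ((u + 617 / 4) * (u + 645 / 4)) := by
      rw [show -(-145 - u) + 37 / 4 = u + 617 / 4 by ring,
        show -(-145 - u) + 65 / 4 = u + 645 / 4 by ring]
      ring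
    have e3 : (265 / 4) / ((u + 81) * (u + 589 / 4)) ≤
        240 / ((u + 617 / 4) * (u + 645 / 4)) := by
      rw [div_le_div_iff₀ (by positivity) (by positivity)]
      nlinarith
    linarith
  rw [Multiset.sum_map_add, Multiset.sum_map_mul_left, Multiset.sum_map_mul_left] at h3
  linarith

/-! ### The logarithmic derivative of ξ left of the critical strip. -/

lemma xiSq_sq_ne_zero {z : ℂ} (hz : z.re ≤ -(1 / 2)) : xiSq (z ^ 2) ≠ 0 := by
  rw [xiSq_sq]
  refine riemannXi_ne_zero_of_re_nonpos ?_
  simp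
  linarith

/-- The logarithmic derivative of `ξ (1 / 2 + z)`. -/
noncomputable def xiLogDeriv (z : ℂ) : ℂ := 2 * z * logDeriv xiSq (z ^ 2)

open ComplexConjugate in
lemma xiLogDeriv_conj (z : ℂ) : xiLogDeriv (conj z) = conj (xiLogDeriv z) := by
  rw [xiLogDeriv, xiLogDeriv, ← map_pow, logDeriv_xiSq_conj]
  simp [conj_ofNat]

open ComplexConjugate in
/-- Approximation of `xiLogDeriv` at a point and its conjugate by finite sums over zeros. -/
lemma exists_xiLogDeriv_approx {z : ℂ} (hz : z.re ≤ -(1 / 2)) {η : ℝ} (hη : 0 < η) :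
    ∃ S : Multiset ℂ, (∀ a ∈ S, xiSq a = 0) ∧
      (S.map fun a ↦ 1 / (-a.re - 64)).sum ≤ 0.0325 ∧
      ‖xiLogDeriv z - (S.map fun a ↦ 2 * z * (1 / (z ^ 2 - a))).sum‖ ≤ η ∧
      ‖xiLogDeriv (conj z) -
        (S.map fun a ↦ 2 * conj z * (1 / (conj z ^ 2 - a))).sum‖ ≤ η := by
  have hz2 : 0 ≤ ‖z‖ := norm_nonneg z
  obtain ⟨S, hS⟩ := exists_isXiApprox (r := max 13 (‖z‖ ^ 2))
    (ε := min (1 / 1000000) (η / (2 * ‖z‖ + 1))) (by positivity) (by positivity)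
  have hmain : ∀ w : ℂ, ‖w‖ = ‖z‖ → w.re = z.re →
      ‖xiLogDeriv w - (S.map fun a ↦ 2 * w * (1 / (w ^ 2 - a))).sum‖ ≤ η := by
    intro w hw hwre
    have h1 := hS.logDeriv (w ^ 2) (by rw [norm_pow, hw]; exact le_max_right _ _)
      (xiSq_sq_ne_zero (by rw [hwre]; exact hz))
    rw [xiLogDeriv, Multiset.sum_map_mul_left, ← mul_sub, norm_mul, norm_mul, hw]
    simp only [RCLike.norm_ofNat]
    calc 2 * ‖z‖ * ‖_‖ ≤ 2 * ‖z‖ * (η / (2 * ‖z‖ + 1)) := by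
          gcongr
          exact h1.trans (min_le_right _ _)
      _ ≤ η := by
          rw [← mul_div_assoc, div_le_iff₀ (by positivity)]
          nlinarith
  exact ⟨S, hS.zero, hS.sum_inv_le (le_max_left _ _) (min_le_left _ _), hmain z rfl rfl,
    hmain _ (norm_conj z) (conj_re z)⟩

lemma two_mul_inv_sq_sub_sq {z w : ℂ} (h : z ^ 2 ≠ w ^ 2) :
    2 * z * (1 / (z ^ 2 - w ^ 2)) = 1 / (z - w) + 1 / (z + w) := by
  have h1 : z - w ≠ 0 := fun h' ↦ h (by rw [sub_eq_zero.1 h'])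
  have h2 : z + w ≠ 0 := fun h' ↦ h (by rw [eq_neg_of_add_eq_zero_left h', neg_sq])
  rw [show z ^ 2 - w ^ 2 = (z - w) * (z + w) by ring]
  field_simp
  ring

lemma multiset_re_sum (S : Multiset ℂ) (f : ℂ → ℂ) :
    (S.map f).sum.re = (S.map fun a ↦ (f a).re).sum := by
  induction S using Multiset.induction with
  | empty => simp
  | cons a S ih => simp [ih]

lemma multiset_im_sum (S : Multiset ℂ) (f : ℂ → ℂ) :
    (S.map f).sum.im = (S.map fun a ↦ (f a).im).sum := by
  induction S using Multiset.induction with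
  | empty => simp
  | cons a S ih => simp [ih]

lemma re_one_div_nonpos {z : ℂ} (h : z.re ≤ 0) : (1 / z).re ≤ 0 := by
  rw [one_div, inv_re]
  exact div_nonpos_of_nonpos_of_nonneg h (normSq_nonneg z)

/-- The zero a = w² contributes 1/(z-w) + 1/(z+w), and both denominators have real part at most 0
because |Re w| ≤ 1/2. -/
lemma re_xiLogDeriv_nonpos {z : ℂ} (hz : z.re ≤ -(1 / 2)) : (xiLogDeriv z).re ≤ 0 := by
  refine le_of_forall_pos_le_add fun η hη ↦ ?_
  obtain ⟨S, hS, -, h, -⟩ := exists_xiLogDeriv_approx hz hη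
  have h1 := (le_abs_self _).trans ((abs_re_le_norm _).trans h)
  rw [sub_re, multiset_re_sum] at h1
  have h2 : (S.map fun a ↦ (2 * z * (1 / (z ^ 2 - a))).re).sum ≤ 0 := by
    refine (Multiset.sum_map_le_sum_map _ (fun _ ↦ 0) fun a ha ↦ ?_).trans (by simp)
    have hne : z ^ 2 ≠ a := fun h ↦ xiSq_sq_ne_zero hz (by rw [h]; exact hS a ha)
    obtain ⟨δ, γ, hδ, -, -, rfl⟩ := exists_of_xiSq_eq_zero (hS a ha)
    have hδ' : |δ| ≤ 1 / 2 := abs_le_of_sq_le_sq (by linarith) (by norm_num)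
    obtain ⟨hδ1, hδ2⟩ := abs_le.1 hδ'
    rw [two_mul_inv_sq_sub_sq hne, add_re]
    refine add_nonpos (re_one_div_nonpos ?_) (re_one_div_nonpos ?_) <;> simp <;> linarith
  linarith

lemma im_one_div (x y : ℝ) : (1 / (x + y * I : ℂ)).im = -y / (x ^ 2 + y ^ 2) := by
  rw [one_div, inv_im, normSq_add_mul_I]
  simp

/-- Contribution of one zero to the imaginary part of `xiLogDeriv`, averaged with the conjugate. -/
lemma im_pair_le {x y δ γ : ℝ} (hy : 0 < y) (hγ : y < γ) :
    (1 / ((x + y * I) - (δ + γ * I) : ℂ) + 1 / ((x + y * I) + (δ + γ * I))).im -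
      (1 / ((x + (-y : ℝ) * I) - (δ + γ * I) : ℂ) + 1 / ((x + (-y : ℝ) * I) + (δ + γ * I))).im ≤
      4 * y / (γ ^ 2 - y ^ 2) := by
  have e1 : ((x + y * I) - (δ + γ * I) : ℂ) = ((x - δ : ℝ) : ℂ) + ((y - γ : ℝ) : ℂ) * I := by
    push_cast; ring
  have e2 : ((x + y * I) + (δ + γ * I) : ℂ) = ((x + δ : ℝ) : ℂ) + ((y + γ : ℝ) : ℂ) * I := by
    push_cast; ring
  have e3 : ((x + (-y : ℝ) * I) - (δ + γ * I) : ℂ) =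
      ((x - δ : ℝ) : ℂ) + ((-y - γ : ℝ) : ℂ) * I := by push_cast; ring
  have e4 : ((x + (-y : ℝ) * I) + (δ + γ * I) : ℂ) =
      ((x + δ : ℝ) : ℂ) + ((-y + γ : ℝ) : ℂ) * I := by push_cast; ring
  rw [e1, e2, e3, e4, add_im, add_im, im_one_div, im_one_div, im_one_div, im_one_div]
  have key : ∀ D : ℝ, 0 ≤ D → (γ - y) / (D + (γ - y) ^ 2) - (γ + y) / (D + (γ + y) ^ 2) ≤
      2 * y / (γ ^ 2 - y ^ 2) := by
    intro D hD
    have hA : 0 < γ - y := by linarith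
    have hB : 0 < γ + y := by linarith
    have h1 : 2 * y / (γ ^ 2 - y ^ 2) = 1 / (γ - y) - 1 / (γ + y) := by
      rw [show γ ^ 2 - y ^ 2 = (γ - y) * (γ + y) by ring]
      field_simp
      ring
    have h2 : ∀ A : ℝ, 0 < A → 1 / A - A / (D + A ^ 2) = D / (A * (D + A ^ 2)) := by
      intro A hA
      field_simp
      ring
    -- A/(D + A²) falls short of 1/A by an amount decreasing in A, so the difference is largest at D
    -- = 0.
    have h3 : D / ((γ + y) * (D + (γ + y) ^ 2)) ≤ D / ((γ - y) * (D + (γ - y) ^ 2)) := by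
      gcongr <;> linarith
    rw [← h2 _ hA, ← h2 _ hB] at h3
    rw [h1]
    linarith
  have k1 := key ((x - δ) ^ 2) (sq_nonneg _)
  have k2 := key ((x + δ) ^ 2) (sq_nonneg _)
  rw [show -(y - γ) = γ - y by ring, show (y - γ) ^ 2 = (γ - y) ^ 2 by ring,
    show -(-y - γ) = γ + y by ring, show (-y - γ) ^ 2 = (γ + y) ^ 2 by ring,
    show -(-y + γ) = -(γ - y) by ring, show (-y + γ) ^ 2 = (γ - y) ^ 2 by ring,
    show -(y + γ) = -(γ + y) by ring, show y + γ = γ + y by ring, neg_div, neg_div]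
  have : 4 * y / (γ ^ 2 - y ^ 2) = 2 * (2 * y / (γ ^ 2 - y ^ 2)) := by ring
  linarith

-- The finite multiset need not be stable under conjugation. Using it at both z and its conjugate
-- and subtracting gives twice the imaginary part, with the cancellation that symmetry would
-- provide; hence 4y · 0.0325, halved.
open ComplexConjugate in
lemma im_xiLogDeriv_le {z : ℂ} (hz : z.re ≤ -(1 / 2)) (hy : 0 < z.im) (hy8 : z.im ≤ 8) :
    (xiLogDeriv z).im ≤ 0.065 * z.im := by
  refine le_of_forall_pos_le_add fun η hη ↦ ?_
  obtain ⟨S, hS, hsum, h, h'⟩ := exists_xiLogDeriv_approx hz hη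
  have h1 := (le_abs_self _).trans ((abs_im_le_norm _).trans h)
  have h2 := (neg_abs_le _).trans' (neg_le_neg ((abs_im_le_norm _).trans h'))
  rw [sub_im, multiset_im_sum] at h1 h2
  rw [xiLogDeriv_conj, conj_im] at h2
  have h3 : (S.map fun a ↦ (2 * z * (1 / (z ^ 2 - a))).im).sum -
      (S.map fun a ↦ (2 * conj z * (1 / (conj z ^ 2 - a))).im).sum ≤ 4 * z.im * 0.0325 := by
    rw [← Multiset.sum_map_sub]
    refine le_trans ?_ (mul_le_mul_of_nonneg_left hsum (by positivity))
    rw [← Multiset.sum_map_mul_left]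
    refine Multiset.sum_map_le_sum_map _ _ fun a ha ↦ ?_
    have hne : z ^ 2 ≠ a := fun h ↦ xiSq_sq_ne_zero hz (by rw [h]; exact hS a ha)
    have hne' : conj z ^ 2 ≠ a := fun h ↦
      xiSq_sq_ne_zero (z := conj z) (by simpa using hz) (by rw [h]; exact hS a ha)
    have hre := re_lt_of_xiSq_eq_zero (hS a ha)
    obtain ⟨δ, γ, hδ, hγ, -, rfl⟩ := exists_of_xiSq_eq_zero (hS a ha)
    have hre' : ((δ + γ * I : ℂ) ^ 2).re = δ ^ 2 - γ ^ 2 := by simp [sq]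
    rw [hre'] at hre ⊢
    rw [two_mul_inv_sq_sub_sq hne, two_mul_inv_sq_sub_sq hne']
    have hyγ : z.im < γ := by nlinarith [sq_nonneg δ]
    have hc : conj z = z.re + (-z.im : ℝ) * I := by
      apply Complex.ext <;> simp
    have := im_pair_le (x := z.re) (δ := δ) hy hyγ
    rw [← hc, re_add_im] at this
    refine this.trans ?_
    rw [mul_one_div]
    apply div_le_div_of_nonneg_left (by positivity) (by linarith)
    nlinarith
  linarith

lemma norm_xiLogDeriv_le {z : ℂ} (hz : z.re ≤ -(1 / 2)) (hz2 : ‖z‖ ^ 2 ≤ 64) :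
    ‖xiLogDeriv z‖ ≤ 0.065 * ‖z‖ := by
  refine le_of_forall_pos_le_add fun η hη ↦ ?_
  obtain ⟨S, hS, hsum, h, -⟩ := exists_xiLogDeriv_approx hz hη
  have h1 := (norm_sub_norm_le _ _).trans h
  have h2 : ‖(S.map fun a ↦ 2 * z * (1 / (z ^ 2 - a))).sum‖ ≤ 2 * ‖z‖ * 0.0325 := by
    refine (norm_multiset_sum_le _).trans ?_
    rw [Multiset.map_map]
    refine le_trans ?_ (mul_le_mul_of_nonneg_left hsum (by positivity))
    rw [← Multiset.sum_map_mul_left]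
    refine Multiset.sum_map_le_sum_map _ _ fun a ha ↦ ?_
    have hre := re_lt_of_xiSq_eq_zero (hS a ha)
    simp only [Function.comp_apply, norm_mul, norm_div, norm_one, RCLike.norm_ofNat]
    gcongr
    · linarith
    · have h3 := norm_sub_norm_le a (z ^ 2)
      have h4 := neg_le_of_abs_le (abs_re_le_norm a)
      rw [norm_pow, norm_sub_rev] at h3
      linarith
  linarith

/-! ### Euler's limit formula for the digamma function. -/

/-- Pointwise convergence with a uniform bound implies convergence of derivatives. -/
lemma tendsto_deriv_of_bounded {f : ℕ → ℂ → ℂ} {g : ℂ → ℂ} {U : Set ℂ} (hU : IsOpen U)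
    (hf : ∀ᶠ n in atTop, DifferentiableOn ℂ (f n) U) (hg : DifferentiableOn ℂ g U)
    (hlim : ∀ w ∈ U, Tendsto (fun n ↦ f n w) atTop (𝓝 (g w))) {z : ℂ} {r M : ℝ} (hr : 0 < r)
    (hball : closedBall z r ⊆ U) (hM : ∀ᶠ n in atTop, ∀ w ∈ closedBall z r, ‖f n w‖ ≤ M) :
    Tendsto (fun n ↦ deriv (f n) z) atTop (𝓝 (deriv g z)) := by
  have hcirc : ∀ θ, circleMap z r θ ∈ closedBall z r := fun θ ↦
    circleMap_mem_closedBall z hr.le θ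
  -- Cauchy's integral for the derivative, with dominated convergence on the circle.
  have h1 : Tendsto (fun n ↦ cderiv r (f n) z) atTop (𝓝 (cderiv r g z)) := by
    unfold cderiv circleIntegral
    refine Tendsto.const_smul ?_ _
    refine intervalIntegral.tendsto_integral_filter_of_dominated_convergence
      (fun _ ↦ r * (((r ^ 2)⁻¹) * M)) ?_ ?_ (by simp) ?_
    · filter_upwards [hf] with n hn
      refine Continuous.aestronglyMeasurable ?_
      have hc : Continuous fun θ ↦ f n (circleMap z r θ) :=
        hn.continuousOn.comp_continuous (continuous_circleMap z r) fun θ ↦ hball (hcirc θ)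
      have hd : Continuous fun θ ↦ ((circleMap z r θ - z) ^ 2)⁻¹ := by
        refine Continuous.inv₀ (by fun_prop) fun θ ↦ ?_
        have : circleMap z r θ ≠ z := circleMap_ne_center hr.ne'
        exact pow_ne_zero 2 (sub_ne_zero.2 this)
      have he : Continuous fun θ ↦ deriv (circleMap z r) θ := by
        simp only [deriv_circleMap]
        fun_prop
      exact he.smul (hd.smul hc)
    · filter_upwards [hM] with n hn
      refine Eventually.of_forall fun θ _ ↦ ?_
      have h2 : ‖circleMap z r θ - z‖ = r := by simp [circleMap, abs_of_pos hr]
      rw [norm_smul, norm_smul, deriv_circleMap, norm_inv, norm_pow, h2, norm_mul, norm_I, mul_one,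
        norm_circleMap_zero, abs_of_pos hr]
      gcongr
      exact hn _ (hcirc θ)
    · refine Eventually.of_forall fun θ _ ↦ ?_
      exact ((hlim _ (hball (hcirc θ))).const_smul _).const_smul _
  rw [cderiv_eq_deriv hU hg hr hball] at h1
  refine h1.congr' ?_
  filter_upwards [hf] with n hn
  exact cderiv_eq_deriv hU hn hr hball

lemma Complex.differentiable_GammaSeq {n : ℕ} (hn : n ≠ 0) {s : ℂ}
    (hs : ∀ m : ℕ, s ≠ -m) :
    DifferentiableAt ℂ (fun s ↦ GammaSeq s n) s ∧
      logDeriv (fun s ↦ GammaSeq s n) s =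
        Real.log n - ∑ j ∈ Finset.range (n + 1), 1 / (s + j) := by
  have hn' : (n : ℂ) ≠ 0 := Nat.cast_ne_zero.2 hn
  have hne : ∀ j : ℕ, s + j ≠ 0 := fun j h ↦ hs j (eq_neg_of_add_eq_zero_left h)
  have hprod : ∏ j ∈ Finset.range (n + 1), (s + j) ≠ 0 := Finset.prod_ne_zero_iff.2 fun j _ ↦ hne j
  have h1 : HasDerivAt (fun s : ℂ ↦ (n : ℂ) ^ s) ((n : ℂ) ^ s * Complex.log n) s := by
    simpa using (hasDerivAt_id s).const_cpow (Or.inl hn')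
  have h2 : DifferentiableAt ℂ (fun s : ℂ ↦ ∏ j ∈ Finset.range (n + 1), (s + j)) s := by
    fun_prop
  have hfun : (fun s ↦ GammaSeq s n) =
      fun s : ℂ ↦ ((n : ℂ) ^ s * n.factorial) / ∏ j ∈ Finset.range (n + 1), (s + j) := rfl
  have hfac : (n.factorial : ℂ) ≠ 0 := Nat.cast_ne_zero.2 n.factorial_ne_zero
  have hpow : (n : ℂ) ^ s ≠ 0 := by simp [cpow_eq_zero_iff, hn']
  refine ⟨?_, ?_⟩
  · rw [hfun]
    exact (h1.differentiableAt.mul_const _).div h2 hprod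
  · rw [hfun, logDeriv_div (f := fun s : ℂ ↦ (n : ℂ) ^ s * n.factorial) s (mul_ne_zero hpow hfac)
        hprod (h1.differentiableAt.mul_const _) h2,
      logDeriv_mul_const s _ hfac, logDeriv_apply, h1.deriv, mul_div_cancel_left₀ _ hpow,
      logDeriv_prod (fun j _ ↦ hne j) (fun j _ ↦ by fun_prop), natCast_log]
    congr 1
    refine Finset.sum_congr rfl fun j _ ↦ ?_
    have : HasDerivAt (fun s : ℂ ↦ s + j) 1 s := (hasDerivAt_id s).add_const _
    rw [logDeriv_apply, this.deriv]

-- Convexity bounds the Euler approximants on an interval by their values at its ends, where they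
-- converge; this is the uniform bound needed to differentiate the limit.
open Real.BohrMollerup in
lemma convexOn_logGammaSeq (n : ℕ) : ConvexOn ℝ (Set.Ioi 0) fun x ↦ logGammaSeq x n := by
  have h1 : ConcaveOn ℝ (Set.Ioi 0) fun x : ℝ ↦ ∑ m ∈ Finset.range (n + 1), Real.log (x + m) := by
    induction n + 1 with
    | zero => simpa using concaveOn_const 0 (convex_Ioi 0)
    | succ k ih =>
      simp_rw [Finset.sum_range_succ]
      refine ih.add ?_
      have := (strictConcaveOn_log_Ioi.concaveOn.translate_left (k : ℝ)).subset
        (show Set.Ioi 0 ⊆ _ from fun x (hx : 0 < x) ↦ by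
          simp only [Set.mem_preimage, Set.mem_Ioi]; positivity) (convex_Ioi 0)
      exact this
  have h2 : ConvexOn ℝ (Set.Ioi 0) fun x : ℝ ↦ x * Real.log n + Real.log n.factorial := by
    refine ⟨convex_Ioi 0, fun x _ y _ a b _ _ hab ↦ le_of_eq ?_⟩
    simp only [smul_eq_mul]
    linear_combination (-(Real.log n.factorial)) * hab
  exact h2.sub h1

open Real.BohrMollerup in
lemma norm_GammaSeq_le {n : ℕ} (hn : n ≠ 0) {s : ℂ} (hs : 0 < s.re) :
    ‖GammaSeq s n‖ ≤ Real.exp (logGammaSeq s.re n) := by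
  have hnpos : (0 : ℝ) < n := by positivity
  have hpos : ∀ j : ℕ, 0 < s.re + j := fun j ↦ by positivity
  have e : Real.exp (logGammaSeq s.re n) =
      (n : ℝ) ^ s.re * n.factorial / ∏ j ∈ Finset.range (n + 1), (s.re + j) := by
    rw [logGammaSeq, Real.exp_sub, Real.exp_add, Real.exp_log (by positivity),
      Real.rpow_def_of_pos hnpos, mul_comm s.re, Real.exp_sum]
    congr 1
    exact Finset.prod_congr rfl fun j _ ↦ Real.exp_log (hpos j)
  rw [e, GammaSeq, norm_div, norm_mul, norm_natCast_cpow_of_pos (Nat.pos_of_ne_zero hn),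
    Complex.norm_natCast, norm_prod]
  have h2 : ∀ j ∈ Finset.range (n + 1), s.re + j ≤ ‖s + j‖ := fun j _ ↦ by
    simpa using re_le_norm (s + j)
  have h3 : 0 < ∏ j ∈ Finset.range (n + 1), (s.re + j) := Finset.prod_pos fun j _ ↦ hpos j
  gcongr with j hj
  exact h2 j hj

open Real.BohrMollerup in
lemma tendsto_digamma_of_re_pos {s : ℂ} (hs : 0 < s.re) :
    Tendsto (fun n : ℕ ↦ (Real.log n - ∑ j ∈ Finset.range (n + 1), 1 / (s + j) : ℂ)) atTop
      (𝓝 (digamma s)) := by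
  set U : Set ℂ := {w | 0 < w.re} with hU
  have hUo : IsOpen U := isOpen_lt continuous_const continuous_re
  have hne : ∀ w ∈ U, ∀ m : ℕ, w ≠ -m := by
    rintro w (hw : 0 < w.re) m rfl
    have h' : (0 : ℝ) ≤ m := Nat.cast_nonneg m
    simp at hw
    linarith
  set r := s.re / 2 with hr
  have hrpos : 0 < r := by positivity
  have hball : ∀ w ∈ closedBall s r, r ≤ w.re ∧ w.re ≤ 3 * r := by
    intro w hw
    rw [mem_closedBall, dist_eq_norm] at hw
    have := abs_le.1 ((abs_re_le_norm _).trans hw)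
    rw [sub_re] at this
    constructor <;> linarith [this.1, this.2]
  have hb : ∀ x : ℝ, 0 < x → ∃ B, ∀ᶠ n : ℕ in atTop, logGammaSeq x n ≤ B := fun x hx ↦
    ⟨Real.log (Real.Gamma x) + 1,
      (tendsto_log_gamma hx).eventually_le_const (by linarith)⟩
  obtain ⟨B₁, hB₁⟩ := hb r hrpos
  obtain ⟨B₂, hB₂⟩ := hb (3 * r) (by positivity)
  have hder := tendsto_deriv_of_bounded (f := fun n s ↦ GammaSeq s n) (g := Gamma) hUo
    (z := s) (r := r) (M := Real.exp (max B₁ B₂))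
    (by
      filter_upwards [eventually_ne_atTop 0] with n hn w hw
      exact (differentiable_GammaSeq hn (hne w hw)).1.differentiableWithinAt)
    (fun w hw ↦ (differentiableAt_Gamma w (hne w hw)).differentiableWithinAt)
    (fun w _ ↦ GammaSeq_tendsto_Gamma w) hrpos
    (fun w hw ↦ by
      have := (hball w hw).1
      simp only [hU, Set.mem_ofPred_eq]
      linarith)
    (by
      filter_upwards [eventually_ne_atTop 0, hB₁, hB₂] with n hn h1 h2 w hw
      obtain ⟨h3, h4⟩ := hball w hw
      refine (norm_GammaSeq_le hn (by linarith)).trans (Real.exp_le_exp.2 ?_)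
      exact ((convexOn_logGammaSeq n).le_max_of_mem_Icc (x := r) (y := 3 * r) hrpos
        (by simp only [Set.mem_Ioi]; linarith) ⟨h3, h4⟩).trans (max_le_max h1 h2))
  have h := hder.div (GammaSeq_tendsto_Gamma s) (Gamma_ne_zero (hne s hs))
  rw [digamma_def, logDeriv_apply]
  refine h.congr' ?_
  filter_upwards [eventually_ne_atTop 0] with n hn
  rw [← (differentiable_GammaSeq hn (hne s hs)).2, logDeriv_apply]
  rfl

/-- Euler's limit formula for the digamma function. -/
theorem tendsto_digamma {s : ℂ} (hs : ∀ m : ℕ, s ≠ -m) :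
    Tendsto (fun n : ℕ ↦ (Real.log n - ∑ j ∈ Finset.range (n + 1), 1 / (s + j) : ℂ)) atTop
      (𝓝 (digamma s)) := by
  obtain ⟨k, hk⟩ := exists_nat_gt (-s.re)
  induction k generalizing s with
  | zero => exact tendsto_digamma_of_re_pos (by simpa using hk)
  | succ k ih =>
    have hs1 : ∀ m : ℕ, s + 1 ≠ -m := fun m h ↦ hs (m + 1) (by push_cast; linear_combination h)
    have h1 := ih hs1 (by simp only [add_re, one_re]; push_cast at hk; linarith)
    rw [digamma_apply_add_one s hs] at h1
    have h2 : Tendsto (fun n : ℕ ↦ 1 / (s + (n + 1 : ℕ))) atTop (𝓝 0) := by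
      simp only [one_div]
      refine tendsto_inv₀_cobounded.comp ?_
      exact (tendsto_const_add_cobounded s).comp
        ((tendsto_natCast_atTop_cobounded (α := ℂ)).comp (tendsto_add_atTop_nat 1))
    -- Leftward induction: passing from s + 1 to s adds the term 1/s and drops the last term, which
    -- tends to 0.
    have h3 := (h1.add h2).sub_const s⁻¹
    rw [add_zero, add_sub_cancel_right] at h3
    refine h3.congr fun n ↦ ?_
    have h4 : ∑ j ∈ Finset.range (n + 1), 1 / (s + 1 + j) =
        (∑ j ∈ Finset.range (n + 1), 1 / (s + j)) + 1 / (s + (n + 1 : ℕ)) - s⁻¹ := by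
      rw [← Finset.sum_range_succ (fun j : ℕ ↦ 1 / (s + j)),
        Finset.sum_range_succ' (fun j : ℕ ↦ 1 / (s + j)) (n + 1)]
      simp only [Nat.cast_zero, add_zero, one_div, add_sub_cancel_right]
      refine Finset.sum_congr rfl fun j _ ↦ ?_
      push_cast
      rw [add_assoc, add_comm 1 (j : ℂ)]
    rw [h4]
    ring

/-! ### Explicit bounds for the digamma function. -/

lemma ne_neg_natCast_of_im_ne_zero {z : ℂ} (hz : z.im ≠ 0) (m : ℕ) : z ≠ -m := by
  rintro rfl
  simp at hz

lemma sum_le_im_digamma {z : ℂ} (hz : 0 < z.im) (N : ℕ) :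
    ∑ n ∈ Finset.range N, z.im / ((z.re + n) ^ 2 + z.im ^ 2) ≤ (digamma z).im := by
  have h := (continuous_im.tendsto _).comp
    (tendsto_digamma (ne_neg_natCast_of_im_ne_zero hz.ne'))
  refine ge_of_tendsto h ?_
  filter_upwards [eventually_ge_atTop N] with n hn
  have e : ∀ j : ℕ, (1 / (z + j)).im = -(z.im / ((z.re + j) ^ 2 + z.im ^ 2)) := fun j ↦ by
    rw [one_div, inv_im, normSq_apply]
    simp only [add_im, natCast_im, add_zero, add_re, natCast_re]
    rw [neg_div, ← sq, ← sq]
  simp only [Function.comp_apply, sub_im, ofReal_im, im_sum, e, Finset.sum_neg_distrib, zero_sub,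
    neg_neg]
  exact Finset.sum_le_sum_of_subset_of_nonneg (Finset.range_subset_range.2 (by omega))
    fun j _ _ ↦ by positivity

/-- Midpoint rule for 1/w on a unit interval: with u = 1/(2w), the even terms of log(1+u) - log(1-u)
cancel and the error is at most |u|³. -/
lemma abs_re_one_div_sub_log_le {w : ℂ} (hw : 3 / 2 ≤ ‖w‖) :
    |(1 / w).re - (Real.log ‖w + 1 / 2‖ - Real.log ‖w - 1 / 2‖)| ≤ 1 / (8 * ‖w‖ ^ 3) := by
  have hw0 : w ≠ 0 := norm_pos_iff.1 (by linarith)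
  set u : ℂ := 1 / (2 * w) with hu
  have hun : ‖u‖ = 1 / (2 * ‖w‖) := by simp [hu]
  have hu3 : ‖u‖ ≤ 1 / 3 := by
    rw [hun]
    gcongr
    linarith
  have hinv : (1 - ‖u‖)⁻¹ ≤ 3 / 2 := by
    rw [inv_le_comm₀ (by linarith) (by norm_num)]
    linarith
  have key : ∀ v : ℂ, ‖v‖ = ‖u‖ → ‖log (1 + v) - (v - v ^ 2 / 2)‖ ≤ ‖u‖ ^ 3 / 2 := by
    intro v hv
    have h := norm_log_sub_logTaylor_le 2 (z := v) (by rw [hv]; linarith)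
    have e : logTaylor (2 + 1) v = v - v ^ 2 / 2 := by
      simp [logTaylor_succ, logTaylor_zero]
      ring
    rw [e, hv] at h
    refine h.trans ?_
    have : ‖u‖ ^ (2 + 1) * (1 - ‖u‖)⁻¹ ≤ ‖u‖ ^ 3 * (3 / 2) := by gcongr
    push_cast
    linarith
  have h1 := key u rfl
  have h2 := key (-u) (norm_neg u)
  have h3 : ‖2 * u - (log (1 + u) - log (1 + -u))‖ ≤ ‖u‖ ^ 3 := by
    calc _ = ‖(log (1 + -u) - (-u - (-u) ^ 2 / 2)) - (log (1 + u) - (u - u ^ 2 / 2))‖ := by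
          congr 1
          ring
      _ ≤ _ := (norm_sub_le _ _).trans (by linarith)
  have hne : 1 + u ≠ 0 := fun h ↦ by
    rw [← neg_eq_of_add_eq_zero_right h, norm_neg, norm_one] at hu3
    norm_num at hu3
  have hne' : 1 + -u ≠ 0 := fun h ↦ by
    rw [← norm_neg, ← neg_eq_of_add_eq_zero_right h, norm_neg, norm_one] at hu3
    norm_num at hu3
  have e1 : w + 1 / 2 = w * (1 + u) := by
    rw [hu]
    field_simp
  have e2 : w - 1 / 2 = w * (1 + -u) := by
    rw [hu]
    field_simp
    ring
  have e3 : (1 / w).re - (Real.log ‖w + 1 / 2‖ - Real.log ‖w - 1 / 2‖) =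
      (2 * u - (log (1 + u) - log (1 + -u))).re := by
    rw [e1, e2, norm_mul, norm_mul, Real.log_mul (norm_ne_zero_iff.2 hw0) (norm_ne_zero_iff.2 hne),
      Real.log_mul (norm_ne_zero_iff.2 hw0) (norm_ne_zero_iff.2 hne'), sub_re, sub_re, log_re,
      log_re, show 2 * u = 1 / w by rw [hu]; field_simp]
    ring
  rw [e3]
  refine (abs_re_le_norm _).trans (h3.trans (le_of_eq ?_))
  rw [hun]
  field_simp
  norm_num

lemma tendsto_log_sub_log_norm_add (w : ℂ) :
    Tendsto (fun n : ℕ ↦ Real.log n - Real.log ‖w + n‖) atTop (𝓝 0) := by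
  have h1 : Tendsto (fun n : ℕ ↦ w / n + 1) atTop (𝓝 (0 + 1)) :=
    (tendsto_const_div_atTop_nhds_zero_nat w).add_const 1
  have h2 : Tendsto (fun n : ℕ ↦ -Real.log ‖w / n + 1‖) atTop (𝓝 0) := by
    have := (h1.norm.log (by simp)).neg
    simpa using this
  have hne : ∀ᶠ n : ℕ in atTop, w / n + 1 ≠ 0 := h1.eventually_ne (by simp)
  refine h2.congr' ?_
  filter_upwards [hne, eventually_ne_atTop 0] with n hn hn0
  have hn0' : (n : ℂ) ≠ 0 := Nat.cast_ne_zero.2 hn0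
  have e : w + n = n * (w / n + 1) := by field_simp
  rw [e, norm_mul, Real.log_mul (norm_ne_zero_iff.2 hn0') (norm_ne_zero_iff.2 hn),
    Complex.norm_natCast]
  ring

/-- Comparison of the real part of the digamma function with a logarithm. -/
lemma abs_re_digamma_sub_log_le {z : ℂ} {E : ℝ} (hz : ∀ j : ℕ, 3 / 2 ≤ ‖z + j‖)
    (hE : ∀ n : ℕ, ∑ j ∈ Finset.range n, 1 / (8 * ‖z + j‖ ^ 3) ≤ E) :
    |(digamma z).re - Real.log ‖z - 1 / 2‖| ≤ E := by
  have hne : ∀ m : ℕ, z ≠ -m := by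
    rintro m rfl
    have := hz m
    norm_num at this
  have h := (continuous_re.tendsto _).comp (tendsto_digamma hne)
  have h0 : Tendsto (fun n : ℕ ↦ Real.log n - Real.log ‖z + 1 / 2 + n‖) atTop (𝓝 0) :=
    tendsto_log_sub_log_norm_add _
  have h1 := ((h.sub h0).sub_const (Real.log ‖z - 1 / 2‖)).abs
  rw [sub_zero] at h1
  refine le_of_tendsto h1 (Eventually.of_forall fun n ↦ ?_)
  have tel : ∑ j ∈ Finset.range (n + 1),
      (Real.log ‖z + j + 1 / 2‖ - Real.log ‖z + j - 1 / 2‖) =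
        Real.log ‖z + 1 / 2 + n‖ - Real.log ‖z - 1 / 2‖ := by
    have := Finset.sum_range_sub (fun j : ℕ ↦ Real.log ‖z + j - 1 / 2‖) (n + 1)
    simp only [Nat.cast_zero, add_zero] at this
    rw [show z + 1 / 2 + n = z + (n + 1 : ℕ) - 1 / 2 by push_cast; ring, ← this]
    refine Finset.sum_congr rfl fun j _ ↦ ?_
    rw [show z + j + 1 / 2 = z + (j + 1 : ℕ) - 1 / 2 by push_cast; ring]
  have e : ((re ∘ fun n : ℕ ↦ (Real.log n - ∑ j ∈ Finset.range (n + 1), 1 / (z + j) : ℂ)) n -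
      (Real.log n - Real.log ‖z + 1 / 2 + n‖) - Real.log ‖z - 1 / 2‖) =
      -∑ j ∈ Finset.range (n + 1), ((1 / (z + j)).re -
        (Real.log ‖z + j + 1 / 2‖ - Real.log ‖z + j - 1 / 2‖)) := by
    rw [Finset.sum_sub_distrib, tel]
    simp only [Function.comp_apply, sub_re, ofReal_re, re_sum]
    ring
  rw [e, abs_neg]
  exact (Finset.abs_sum_le_sum_abs _ _).trans
    ((Finset.sum_le_sum fun j _ ↦ abs_re_one_div_sub_log_le (hz j)).trans (hE _))

lemma one_div_sq_add_le_arctan_sub (v : ℝ) :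
    1 / (v ^ 2 + 16) ≤ 0.3 * (Real.arctan ((v + 1 / 2) / 4) - Real.arctan ((v - 1 / 2) / 4)) := by
  have hlt : (v - 1 / 2) / 4 < (v + 1 / 2) / 4 := by linarith
  obtain ⟨ξ, ⟨hξ1, hξ2⟩, hξ⟩ := exists_hasDerivAt_eq_slope Real.arctan (fun x ↦ 1 / (1 + x ^ 2)) hlt
    Real.continuous_arctan.continuousOn fun x _ ↦ Real.hasDerivAt_arctan x
  rw [show (v + 1 / 2) / 4 - (v - 1 / 2) / 4 = 1 / 4 by ring,
    eq_div_iff (by norm_num)] at hξ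
  rw [← hξ]
  have h1 : ξ ^ 2 * 16 ≤ v ^ 2 + |v| + 1 / 4 := by
    have : |ξ * 4| ≤ |v| + 1 / 2 := by
      rw [abs_le]
      constructor <;> linarith [neg_abs_le v, le_abs_self v]
    have h2 := pow_le_pow_left₀ (abs_nonneg _) this 2
    rw [sq_abs] at h2
    nlinarith [sq_abs v]
  have h2 : |v| ≤ (v ^ 2 + 16) / 8 := by nlinarith [sq_nonneg (|v| - 4), sq_abs v]
  rw [show (0.3 : ℝ) * (1 / (1 + ξ ^ 2) * (1 / 4)) = 0.075 / (1 + ξ ^ 2) by ring,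
    div_le_div_iff₀ (by positivity) (by positivity)]
  nlinarith

lemma log_sub_le_re_digamma {z : ℂ} (hz : 4 ≤ z.im) :
    Real.log ‖z - 1 / 2‖ - 0.03 ≤ (digamma z).re := by
  have him : ∀ j : ℕ, 4 ≤ ‖z + j‖ := fun j ↦ by
    have := im_le_norm (z + j)
    simp only [add_im, natCast_im, add_zero] at this
    linarith
  have h := abs_re_digamma_sub_log_le (z := z) (E := 0.03) (fun j ↦ by linarith [him j]) ?_
  · linarith [(abs_le.1 h).1]
  intro n
  -- Telescoping majorant of the error sum; the arctangent varies by at most π in all, and 0.3π/32 <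
  -- 0.03.
  set g : ℕ → ℝ := fun j ↦ Real.arctan ((z.re + j - 1 / 2) / 4) with hg
  have hterm : ∀ j : ℕ, 1 / (8 * ‖z + j‖ ^ 3) ≤ 0.3 / 32 * (g (j + 1) - g j) := by
    intro j
    have h1 := one_div_sq_add_le_arctan_sub (z.re + j)
    have h2 : 32 * ((z.re + j) ^ 2 + 16) ≤ 8 * ‖z + j‖ ^ 3 := by
      have e : ‖z + j‖ ^ 2 = (z.re + j) ^ 2 + z.im ^ 2 := by
        rw [← normSq_eq_norm_sq, normSq_apply]
        simp
        ring
      have : (z.re + j) ^ 2 + 16 ≤ ‖z + j‖ ^ 2 := by rw [e]; nlinarith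
      calc 32 * ((z.re + j) ^ 2 + 16) ≤ 8 * (4 * ‖z + j‖ ^ 2) := by linarith
        _ ≤ 8 * (‖z + j‖ * ‖z + j‖ ^ 2) := by gcongr; exact him j
        _ = _ := by ring
    have h3 : 1 / (8 * ‖z + j‖ ^ 3) ≤ 1 / (32 * ((z.re + j) ^ 2 + 16)) :=
      one_div_le_one_div_of_le (by positivity) h2
    have e : g (j + 1) = Real.arctan ((z.re + j + 1 / 2) / 4) := by
      simp only [hg]
      push_cast
      ring_nf
    rw [e]
    simp only [hg]
    rw [← one_div_mul_one_div 32] at h3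
    linarith
  refine (Finset.sum_le_sum fun j _ ↦ hterm j).trans ?_
  rw [← Finset.mul_sum, Finset.sum_range_sub]
  have h1 : g n ≤ Real.pi / 2 := (Real.arctan_lt_pi_div_two _).le
  have h2 : -(Real.pi / 2) ≤ g 0 := (Real.neg_pi_div_two_lt_arctan _).le
  nlinarith [Real.pi_lt_d2]

lemma re_digamma_le {z : ℂ} (h1 : 1 / 2 ≤ z.re) (h2 : z.re ≤ 1) (h3 : |z.im| ≤ 3 / 2) :
    (digamma z).re ≤ 0.82 := by
  have hne : ∀ m : ℕ, z ≠ -m := by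
    rintro m rfl
    have h' : (0 : ℝ) ≤ m := Nat.cast_nonneg m
    simp at h1
    linarith
  have hre : ∀ j : ℕ, (3 / 2 + j : ℝ) ≤ ‖z + 1 + j‖ := fun j ↦ by
    have := re_le_norm (z + 1 + j)
    simp only [add_re, natCast_re, one_re] at this
    linarith
  -- Shifting by 1 ensures all moduli are at least 3/2; the recurrence costs only -Re(1/z) ≤ 0.
  have h := abs_re_digamma_sub_log_le (z := z + 1) (E := 1 / 16)
    (fun j ↦ by linarith [hre j, (Nat.cast_nonneg j : (0 : ℝ) ≤ j)]) ?_
  · rw [digamma_apply_add_one z hne, add_re, show z + 1 - 1 / 2 = z + 1 / 2 by ring] at h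
    have h4 : 0 ≤ (z⁻¹).re := by
      rw [inv_re]
      exact div_nonneg (by linarith) (normSq_nonneg _)
    have h5 : ‖z + 1 / 2‖ ^ 2 ≤ 9 / 2 := by
      rw [← normSq_eq_norm_sq, normSq_apply]
      have := sq_le_sq' (by linarith [(abs_le.1 h3).1]) (abs_le.1 h3).2
      simp
      nlinarith
    have h6 : 2 * Real.log ‖z + 1 / 2‖ ≤ 1.512 := by
      have hpos : 0 < ‖z + 1 / 2‖ := norm_pos_iff.2 fun h ↦ by
        have := congrArg re h
        simp at this
        linarith
      have e : 2 * Real.log ‖z + 1 / 2‖ = Real.log (‖z + 1 / 2‖ ^ 2) := by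
        rw [Real.log_pow]
        norm_num
      have e2 : Real.log (9 / 2) = 2 * Real.log 2 + Real.log (9 / 8) := by
        rw [show (9 / 2 : ℝ) = 2 ^ 2 * (9 / 8) by norm_num, Real.log_mul (by norm_num) (by norm_num),
          Real.log_pow]
        norm_num
      have h7 := Real.log_le_log (by positivity) h5
      have h8 := Real.log_le_sub_one_of_pos (show (0 : ℝ) < 9 / 8 by norm_num)
      linarith [Real.log_two_lt_d9]
    linarith [(abs_le.1 h).2]
  intro n
  set g : ℕ → ℝ := fun j ↦ -(1 / (j + 1 : ℝ) ^ 2) with hg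
  have hterm : ∀ j : ℕ, 1 / (8 * ‖z + 1 + j‖ ^ 3) ≤ 1 / 16 * (g (j + 1) - g j) := by
    intro j
    have hj : (0 : ℝ) ≤ j := Nat.cast_nonneg j
    calc 1 / (8 * ‖z + 1 + j‖ ^ 3) ≤ 1 / (8 * (3 / 2 + j : ℝ) ^ 3) := by
          gcongr
          exact hre j
      _ ≤ _ := by
        simp only [hg]
        push_cast
        rw [show 1 / 16 * (-(1 / ((j : ℝ) + 1 + 1) ^ 2) - -(1 / ((j : ℝ) + 1) ^ 2)) =
            (3 / 2 + j) / (8 * (((j : ℝ) + 1 + 1) ^ 2 * (j + 1) ^ 2)) by field_simp; ring,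
          div_le_div_iff₀ (by positivity) (by positivity)]
        have : (((j : ℝ) + 1 + 1) * (j + 1)) ^ 2 ≤ ((3 / 2 + j) ^ 2) ^ 2 := by
          gcongr
          nlinarith
        nlinarith
  refine (Finset.sum_le_sum fun j _ ↦ hterm j).trans ?_
  rw [← Finset.mul_sum, Finset.sum_range_sub]
  have h1 : g n ≤ 0 := by simp only [hg]; exact neg_nonpos.2 (by positivity)
  have h2 : g 0 = -1 := by simp [hg]
  linarith

/-- The cotangent series at x = it/2 evaluates the sum as (π/4) coth(πt/2) - 1/(2t), and coth ≥ 1.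
-/
lemma one_div_sq_add_four_mul_sq_hasSum {t : ℝ} (ht : 0 < t) :
    ∃ S : ℝ, HasSum (fun n : ℕ ↦ t / ((2 * (n + 1 : ℝ)) ^ 2 + t ^ 2)) S ∧
      Real.pi / 4 - 1 / (2 * t) ≤ S := by
  set x : ℂ := I * (t / 2) with hx
  have hxim : x.im = t / 2 := by
    simp only [hx]
    rw [show (t / 2 : ℂ) = ((t / 2 : ℝ) : ℂ) by push_cast; rfl, I_mul_im, ofReal_re]
  have hxi : x ∈ integerComplement := by
    rintro ⟨n, hn⟩
    have := congrArg im hn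
    rw [hxim] at this
    simp at this
    linarith
  have hsummable : Summable fun n : ℕ ↦ t / ((2 * (n + 1 : ℝ)) ^ 2 + t ^ 2) := by
    refine Summable.of_nonneg_of_le (fun n ↦ by positivity) (fun n ↦ ?_)
      (((summable_nat_add_iff 1).2 (Real.summable_one_div_nat_pow.2 one_lt_two)).mul_left t)
    rw [mul_one_div]
    gcongr
    push_cast
    nlinarith [sq_nonneg t, sq_nonneg (n + 1 : ℝ)]
  refine ⟨_, hsummable.hasSum, ?_⟩
  have hterm : ∀ n : ℕ, (1 / (x - (n + 1)) + 1 / (x + (n + 1)) : ℂ) =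
      -4 * I * ((t / ((2 * (n + 1 : ℝ)) ^ 2 + t ^ 2) : ℝ) : ℂ) := by
    intro n
    have h1 : x - (n + 1) ≠ 0 := fun h ↦ by
      have := congrArg im h
      simp [hxim] at this
      linarith
    have h2 : x + (n + 1) ≠ 0 := fun h ↦ by
      have := congrArg im h
      simp [hxim] at this
      linarith
    have h3 : ((2 * (n + 1 : ℂ)) ^ 2 + (t : ℂ) ^ 2) ≠ 0 := by
      have : (0 : ℝ) < (2 * (n + 1 : ℝ)) ^ 2 + t ^ 2 := by positivity
      exact_mod_cast this.ne'
    have hx2 : x ^ 2 = -(t : ℂ) ^ 2 / 4 := by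
      rw [hx, mul_pow, I_sq]
      ring
    push_cast
    rw [div_add_div _ _ h1 h2, mul_div_assoc', div_eq_div_iff (mul_ne_zero h1 h2) h3]
    have h4 : (x - (n + 1)) * (x + (n + 1)) = -((2 * (n + 1 : ℂ)) ^ 2 + (t : ℂ) ^ 2) / 4 := by
      linear_combination hx2
    rw [h4, hx]
    ring
  have hcot := cot_series_rep' hxi
  simp_rw [hterm] at hcot
  rw [tsum_mul_left, ← ofReal_tsum] at hcot
  set S : ℝ := ∑' n : ℕ, t / ((2 * (n + 1 : ℝ)) ^ 2 + t ^ 2) with hS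
  have hq := pi_mul_cot_pi_q_exp ⟨x, by rw [hxim]; positivity⟩
  dsimp only at hq
  set q : ℝ := Real.exp (-(Real.pi * t)) with hqdef
  have hqe : cexp (2 * Real.pi * I * x) = q := by
    rw [hqdef, ofReal_exp]
    congr 1
    rw [hx]
    push_cast
    linear_combination (Real.pi * t : ℂ) * I_sq
  have hq0 : 0 ≤ q := (Real.exp_pos _).le
  have hq1 : q < 1 := by
    rw [hqdef, Real.exp_lt_one_iff]
    have := Real.pi_pos
    nlinarith [mul_pos Real.pi_pos ht]
  simp_rw [hqe, ← ofReal_pow] at hq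
  rw [← ofReal_tsum, tsum_geometric_of_lt_one hq0 hq1] at hq
  have hinv : 1 ≤ (1 - q)⁻¹ := (one_le_inv₀ (by linarith)).2 (by linarith)
  rw [hq] at hcot
  have hx1 : (1 / x : ℂ) = -(2 / t : ℝ) * I := by
    rw [hx]
    push_cast
    have : (t : ℂ) ≠ 0 := ofReal_ne_zero.2 ht.ne'
    field_simp
    rw [I_sq, neg_neg]
  rw [hx1] at hcot
  set u := (1 - q)⁻¹
  have him := congrArg im hcot
  simp at him
  have h2 : 1 / (2 * t) = 2 / t / 4 := by field_simp; norm_num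
  rw [h2]
  nlinarith [Real.pi_pos, mul_le_mul_of_nonneg_left hinv Real.pi_pos.le]

/-! ### Critical points of ζ and the four regions. -/

lemma hasDerivAt_Gammaℝ {s : ℂ} (hs : s.im ≠ 0) :
    HasDerivAt Gammaℝ (Gammaℝ s * (-(Real.log Real.pi) / 2 + digamma (s / 2) / 2)) s := by
  have hne : ∀ m : ℕ, s / 2 ≠ -m :=
    ne_neg_natCast_of_im_ne_zero (by simpa [div_ofNat_im] using hs)
  have hπ : (Real.pi : ℂ) ≠ 0 := ofReal_ne_zero.2 Real.pi_ne_zero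
  have h1 : HasDerivAt (fun w : ℂ ↦ (Real.pi : ℂ) ^ (-w / 2))
      ((Real.pi : ℂ) ^ (-s / 2) * log Real.pi * (-1 / 2)) s :=
    ((hasDerivAt_neg s).div_const 2).const_cpow (Or.inl hπ)
  have h2 : HasDerivAt (fun w : ℂ ↦ Gamma (w / 2)) (deriv Gamma (s / 2) * (1 / 2)) s :=
    (differentiableAt_Gamma _ hne).hasDerivAt.comp s ((hasDerivAt_id s).div_const 2)
  have h3 : deriv Gamma (s / 2) = digamma (s / 2) * Gamma (s / 2) := by
    rw [digamma_def, logDeriv_apply, div_mul_cancel₀ _ (Gamma_ne_zero hne)]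
  refine (h1.mul h2).congr_deriv ?_
  rw [h3, Gammaℝ_def, ofReal_log Real.pi_pos.le]
  ring

/-- The logarithmic derivative of the functional equation at a critical point of `ζ`. -/
lemma xiLogDeriv_add_eq_zero {s : ℂ} (hs : s.im ≠ 0) (hre : s.re ≤ 0)
    (hζ : deriv riemannZeta s = 0) :
    xiLogDeriv (s - 1 / 2) + 1 / (1 - s) + Real.log Real.pi / 2 - digamma (s / 2 + 1) / 2 = 0 := by
  have hs0 : s ≠ 0 := fun h ↦ hs (by simp [h])
  have hs1 : s ≠ 1 := fun h ↦ hs (by simp [h])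
  have hne : ∀ m : ℕ, s / 2 ≠ -m :=
    ne_neg_natCast_of_im_ne_zero (by simpa [div_ofNat_im] using hs)
  have hG : ∀ w : ℂ, w.im ≠ 0 → Gammaℝ w ≠ 0 := by
    intro w hw h
    obtain ⟨n, hn⟩ := Gammaℝ_eq_zero_iff.1 h
    exact hw (by simp [hn])
  have h1 : HasDerivAt riemannXi
      ((2 * s - 1) / 2 * (Gammaℝ s * riemannZeta s) + s * (s - 1) / 2 *
        (Gammaℝ s * (-(Real.log Real.pi) / 2 + digamma (s / 2) / 2) * riemannZeta s)) s := by
    have hz : HasDerivAt riemannZeta 0 s := hζ ▸ (differentiableAt_riemannZeta hs1).hasDerivAt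
    have hp : HasDerivAt (fun w : ℂ ↦ w * (w - 1) / 2) ((2 * s - 1) / 2) s := by
      refine (((hasDerivAt_id s).mul ((hasDerivAt_id s).sub_const 1)).div_const 2).congr_deriv ?_
      simp only [id]
      ring
    have hprod := (hp.mul ((hasDerivAt_Gammaℝ hs).mul hz)).congr_of_eventuallyEq
      (f₁ := riemannXi) ?_
    · refine hprod.congr_deriv ?_
      simp only [Pi.mul_apply]
      ring
    · have : ∀ᶠ w in 𝓝 s, w.im ≠ 0 := continuous_im.continuousAt.eventually_ne hs
      filter_upwards [this] with w hw
      exact riemannXi_eq (fun h ↦ hw (by simp [h])) (fun h ↦ hw (by simp [h])) (hG w hw)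
  have hzre : (s - 1 / 2).re ≤ -(1 / 2) := by simp; linarith
  have hxi : xiSq ((s - 1 / 2) ^ 2) = riemannXi s := by
    rw [xiSq_sq]
    congr 1
    ring
  have h2 : HasDerivAt riemannXi (xiLogDeriv (s - 1 / 2) * riemannXi s) s := by
    have hq : HasDerivAt (fun w : ℂ ↦ (w - 1 / 2) ^ 2) (2 * (s - 1 / 2)) s := by
      refine (((hasDerivAt_id s).sub_const (1 / 2)).pow 2).congr_deriv ?_
      simp
    have hc := (differentiable_xiSq ((s - 1 / 2) ^ 2)).hasDerivAt.comp s hq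
    have hfun : xiSq ∘ (fun w : ℂ ↦ (w - 1 / 2) ^ 2) = riemannXi := by
      funext w
      rw [Function.comp_apply, xiSq_sq]
      congr 1
      ring
    rw [hfun] at hc
    refine hc.congr_deriv ?_
    rw [xiLogDeriv, logDeriv_apply, ← hxi]
    have := xiSq_sq_ne_zero hzre
    generalize (s - 1 / 2) ^ 2 = v at this ⊢
    field_simp
  have h3 := h1.unique h2
  have hx := riemannXi_ne_zero_of_re_nonpos hre
  have hxe := riemannXi_eq hs0 hs1 (hG s hs)
  have hs1' : s - 1 ≠ 0 := sub_ne_zero.2 hs1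
  have hs1'' : 1 - s ≠ 0 := sub_ne_zero.2 hs1.symm
  have hGζ : Gammaℝ s * riemannZeta s ≠ 0 := fun h ↦ hx (by rw [hxe, h, mul_zero])
  rw [digamma_apply_add_one _ hne]
  rw [hxe] at h3
  set X := xiLogDeriv (s - 1 / 2)
  have h4 : (2 * s - 1) / 2 + s * (s - 1) / 2 *
      (-(Real.log Real.pi) / 2 + digamma (s / 2) / 2) = X * (s * (s - 1) / 2) :=
    mul_right_cancel₀ hGζ (by linear_combination h3)
  have h5 : (s * (s - 1)) * (X + 1 / (1 - s) + Real.log Real.pi / 2 -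
      (digamma (s / 2) + (s / 2)⁻¹) / 2) = 0 := by
    have e1 : s * (s - 1) * (1 / (1 - s)) = -s := by
      field_simp
      ring
    have e2 : s * (s - 1) * (s / 2)⁻¹ = 2 * (s - 1) := by
      field_simp
    linear_combination -2 * h4 + e1 - e2 / 2
  exact (mul_eq_zero.1 h5).resolve_left (mul_ne_zero hs0 hs1')

lemma log_pi_bounds : 1.11 ≤ Real.log Real.pi ∧ Real.log Real.pi ≤ 1.2 := by
  have e : Real.log Real.pi = 2 * Real.log 2 + Real.log (Real.pi / 4) := by
    rw [Real.log_div Real.pi_ne_zero (by norm_num), show (4 : ℝ) = 2 ^ 2 by norm_num, Real.log_pow]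
    norm_num
  have h0 : 0 < Real.pi / 4 := by positivity
  have h1 := Real.log_le_sub_one_of_pos h0
  have h2 := Real.one_sub_inv_le_log_of_pos h0
  have h3 : (Real.pi / 4)⁻¹ ≤ 1.274 := by
    rw [inv_le_comm₀ h0 (by norm_num)]
    norm_num
    linarith [Real.pi_gt_d2]
  constructor <;> linarith [Real.log_two_gt_d9, Real.log_two_lt_d9, Real.pi_lt_d2]

lemma re_one_div_one_sub (s : ℂ) :
    (1 / (1 - s)).re = (1 - s.re) / ((1 - s.re) ^ 2 + s.im ^ 2) := by
  rw [one_div, inv_re, normSq_apply]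
  simp only [sub_re, one_re, sub_im, one_im, zero_sub]
  ring_nf

lemma im_one_div_one_sub (s : ℂ) :
    (1 / (1 - s)).im = s.im / ((1 - s.re) ^ 2 + s.im ^ 2) := by
  rw [one_div, inv_im, normSq_apply]
  simp only [sub_re, one_re, sub_im, one_im, zero_sub]
  ring_nf

lemma deriv_riemannZeta_ne_zero_of_eight_le_im {s : ℂ} (hre : s.re ≤ 0) (him : 8 ≤ s.im) :
    deriv riemannZeta s ≠ 0 := by
  intro hζ
  have h := congrArg re (xiLogDeriv_add_eq_zero (by linarith) hre hζ)
  have h1 : (xiLogDeriv (s - 1 / 2)).re ≤ 0 := re_xiLogDeriv_nonpos (by simp; linarith)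
  have h2 := log_sub_le_re_digamma (z := s / 2 + 1) (by simp [div_ofNat_im]; linarith)
  have h3 : 2 * Real.log 2 ≤ Real.log ‖s / 2 + 1 - 1 / 2‖ := by
    rw [← Nat.cast_two (R := ℝ), ← Real.log_pow]
    refine Real.log_le_log (by norm_num) ?_
    have := im_le_norm (s / 2 + 1 - 1 / 2)
    simp [div_ofNat_im] at this
    norm_num
    linarith
  -- AM-GM: x/(x² + t²) ≤ 1/(2t) ≤ 1/16 for t ≥ 8.
  have h4 : (1 - s.re) / ((1 - s.re) ^ 2 + s.im ^ 2) ≤ 1 / 16 := by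
    rw [div_le_div_iff₀ (by positivity) (by norm_num)]
    nlinarith [sq_nonneg (1 - s.re - 8)]
  simp only [sub_re, add_re, re_one_div_one_sub, div_ofNat_re, ofReal_re, zero_re] at h
  linarith [log_pi_bounds.2, Real.log_two_gt_d9]

lemma sum_le_im_digamma_half_add_one {s : ℂ} (hs : 0 < s.im) (N : ℕ) :
    ∑ n ∈ Finset.range N, s.im / ((s.re + 2 * (n + 1)) ^ 2 + s.im ^ 2) ≤
      (digamma (s / 2 + 1)).im / 2 := by
  have him : (s / 2 + 1).im = s.im / 2 := by simp [div_ofNat_im]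
  have hre : (s / 2 + 1).re = s.re / 2 + 1 := by simp [div_ofNat_re]
  have h := sum_le_im_digamma (z := s / 2 + 1) (by rw [him]; positivity) N
  rw [him, hre] at h
  rw [le_div_iff₀ two_pos, Finset.sum_mul]
  refine le_of_eq_of_le (Finset.sum_congr rfl fun n _ ↦ ?_) h
  rw [div_mul_eq_mul_div, div_eq_div_iff (by positivity) (by positivity)]
  ring

lemma im_xiLogDeriv_add_eq_zero {s : ℂ} (hs : s.im ≠ 0) (hre : s.re ≤ 0)
    (hζ : deriv riemannZeta s = 0) :
    (xiLogDeriv (s - 1 / 2)).im + s.im / ((1 - s.re) ^ 2 + s.im ^ 2) =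
      (digamma (s / 2 + 1)).im / 2 := by
  have h := congrArg im (xiLogDeriv_add_eq_zero hs hre hζ)
  simp only [sub_im, add_im, im_one_div_one_sub, div_ofNat_im, ofReal_im, zero_im] at h
  linarith

lemma im_xiLogDeriv_sub_half_le {s : ℂ} (hre : s.re ≤ 0) (h0 : 0 < s.im) (h8 : s.im ≤ 8) :
    (xiLogDeriv (s - 1 / 2)).im ≤ 0.065 * s.im := by
  have e : (s - 1 / 2).im = s.im := by simp
  have h := im_xiLogDeriv_le (z := s - 1 / 2) (by simp; linarith) (by rwa [e]) (by rwa [e])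
  rwa [e] at h

lemma deriv_riemannZeta_ne_zero_of_im_mem_Icc {s : ℂ} (hre : s.re ≤ 0) (h3 : 3 ≤ s.im)
    (h8 : s.im ≤ 8) : deriv riemannZeta s ≠ 0 := by
  intro hζ
  have hpos : 0 < s.im := by linarith
  have h := im_xiLogDeriv_add_eq_zero hpos.ne' hre hζ
  have h1 := im_xiLogDeriv_sub_half_le hre hpos h8
  obtain ⟨S, hS, hS'⟩ := one_div_sq_add_four_mul_sq_hasSum hpos
  -- Dropping k terms puts Re s + 2k in (-2, 0], so the remaining denominators are at most those of
  -- the cotangent sum.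
  set k := ⌊-s.re / 2⌋₊ with hk
  have hk1 : (k : ℝ) ≤ -s.re / 2 := Nat.floor_le (by linarith)
  have hk2 : -s.re / 2 < k + 1 := Nat.lt_floor_add_one _
  have h4 : S ≤ (digamma (s / 2 + 1)).im / 2 := by
    refine le_of_tendsto' hS.tendsto_sum_nat fun M ↦ ?_
    refine le_trans ?_ (sum_le_im_digamma_half_add_one hpos (k + M))
    rw [Finset.sum_range_add]
    refine le_add_of_nonneg_of_le (Finset.sum_nonneg fun _ _ ↦ by positivity)
      (Finset.sum_le_sum fun m _ ↦ ?_)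
    have hm : (0 : ℝ) ≤ m := Nat.cast_nonneg m
    gcongr
    · push_cast
      linarith
    · push_cast
      linarith
  have h5 : s.im / ((1 - s.re) ^ 2 + s.im ^ 2) ≤ s.im / (1 + s.im ^ 2) := by
    gcongr
    nlinarith
  have h6 : 0.065 * s.im + s.im / (1 + s.im ^ 2) < Real.pi / 4 - 1 / (2 * s.im) := by
    set t := s.im
    have : 0.065 * t + t / (1 + t ^ 2) + 1 / (2 * t) < 0.785 := by
      have e : 0.065 * t + t / (1 + t ^ 2) + 1 / (2 * t) =
          (0.13 * t ^ 2 * (1 + t ^ 2) + 2 * t ^ 2 + (1 + t ^ 2)) / (2 * t * (1 + t ^ 2)) := by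
        field_simp
        ring
      rw [e, div_lt_iff₀ (by positivity)]
      nlinarith [mul_nonneg (sub_nonneg.2 h3) (sub_nonneg.2 h8),
        mul_nonneg (mul_nonneg (sub_nonneg.2 h3) (sub_nonneg.2 h8)) hpos.le,
        mul_nonneg (mul_nonneg (sub_nonneg.2 h3) (sub_nonneg.2 h8)) (sq_nonneg t),
        mul_nonneg (mul_nonneg (sub_nonneg.2 h3) (sub_nonneg.2 h8)) (sq_nonneg (t - 4))]
    linarith [Real.pi_gt_d2]
  linarith

lemma deriv_riemannZeta_ne_zero_of_re_le_neg_one {s : ℂ} (hre : s.re ≤ -1) (h0 : 0 < s.im)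
    (h3 : s.im ≤ 3) : deriv riemannZeta s ≠ 0 := by
  intro hζ
  have h := im_xiLogDeriv_add_eq_zero h0.ne' (by linarith) hζ
  have h1 := im_xiLogDeriv_sub_half_le (by linarith) h0 (by linarith)
  -- Now Re s + 2(k+1) lies in (-1, 1] and Re s + 2(k+2) in (1, 3]; these two terms suffice.
  set k := ⌊(-1 - s.re) / 2⌋₊ with hk
  have hk1 : (k : ℝ) ≤ (-1 - s.re) / 2 := Nat.floor_le (by linarith)
  have hk2 : (-1 - s.re) / 2 < k + 1 := Nat.lt_floor_add_one _
  have h4 := sum_le_im_digamma_half_add_one h0 (k + 2)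
  rw [Finset.sum_range_add, Finset.sum_range_succ, Finset.sum_range_one] at h4
  have h5 : 0 ≤ ∑ n ∈ Finset.range k, s.im / ((s.re + 2 * (n + 1)) ^ 2 + s.im ^ 2) :=
    Finset.sum_nonneg fun _ _ ↦ by positivity
  push_cast at h4
  have h6 : s.im / (1 + s.im ^ 2) ≤ s.im / ((s.re + 2 * (k + 0 + 1)) ^ 2 + s.im ^ 2) := by
    gcongr
    nlinarith
  have h7 : s.im / (9 + s.im ^ 2) ≤ s.im / ((s.re + 2 * (k + 1 + 1)) ^ 2 + s.im ^ 2) := by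
    gcongr
    nlinarith
  have h8 : s.im / ((1 - s.re) ^ 2 + s.im ^ 2) ≤ s.im / (4 + s.im ^ 2) := by
    gcongr
    nlinarith
  have h9 : 0.065 * s.im + s.im / (4 + s.im ^ 2) < s.im / (1 + s.im ^ 2) + s.im / (9 + s.im ^ 2) := by
    set t := s.im
    have ht : t ^ 2 ≤ 9 := by nlinarith
    have key : 0.065 + 1 / (4 + t ^ 2) < 1 / (1 + t ^ 2) + 1 / (9 + t ^ 2) := by
      generalize t ^ 2 = x, sq_nonneg t = hx at ht
      rw [← sub_pos]
      have e : 1 / (1 + x) + 1 / (9 + x) - (0.065 + 1 / (4 + x)) =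
        ((4 + x) * (9 + x) + (1 + x) * (4 + x) - (1 + x) * (9 + x)
          - 0.065 * ((1 + x) * (4 + x) * (9 + x))) / ((1 + x) * (4 + x) * (9 + x)) := by
        field_simp
        ring
      rw [e]
      refine div_pos ?_ (by positivity)
      nlinarith [mul_nonneg hx (sub_nonneg.2 ht), mul_nonneg hx (mul_nonneg hx (sub_nonneg.2 ht))]
    have := mul_lt_mul_of_pos_left key h0
    simp only [mul_add, mul_one_div] at this
    linarith
  linarith

lemma deriv_riemannZeta_ne_zero_of_neg_one_le_re {s : ℂ} (h1 : -1 ≤ s.re) (hre : s.re ≤ 0)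
    (h0 : 0 < s.im) (h3 : s.im ≤ 3) : deriv riemannZeta s ≠ 0 := by
  intro hζ
  have h := congrArg re (xiLogDeriv_add_eq_zero h0.ne' hre hζ)
  simp only [sub_re, add_re, re_one_div_one_sub, div_ofNat_re, ofReal_re, zero_re] at h
  have hre2 : (s - 1 / 2).re = s.re - 1 / 2 := by simp
  have him2 : (s - 1 / 2).im = s.im := by simp
  -- The farthest corner of the box gives 1.5² + 3². The real part is then at least -0.065 · 3.36 +
  -- 0.1 + 0.555 - 0.41 > 0.
  have hn : ‖s - 1 / 2‖ ^ 2 ≤ 11.25 := by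
    rw [← normSq_eq_norm_sq, normSq_apply, hre2, him2]
    nlinarith
  have hn' : ‖s - 1 / 2‖ ≤ 3.36 := by nlinarith [norm_nonneg (s - 1 / 2)]
  have h4 := norm_xiLogDeriv_le (z := s - 1 / 2) (by rw [hre2]; linarith) (by linarith)
  have h5 := (abs_le.1 (abs_re_le_norm (xiLogDeriv (s - 1 / 2)))).1
  have h6 := re_digamma_le (z := s / 2 + 1) (by simp [div_ofNat_re]; linarith)
    (by simp [div_ofNat_re]; linarith) (by
      rw [show (s / 2 + 1).im = s.im / 2 by simp [div_ofNat_im], abs_le]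
      constructor <;> linarith)
  have h7 : 0.1 ≤ (1 - s.re) / ((1 - s.re) ^ 2 + s.im ^ 2) := by
    rw [le_div_iff₀ (by positivity)]
    nlinarith
  linarith [log_pi_bounds.1]

lemma deriv_riemannZeta_conj (s : ℂ) :
    deriv riemannZeta (starRingEnd ℂ s) = starRingEnd ℂ (deriv riemannZeta s) := by
  have h := congrFun (deriv_conj_conj (f := riemannZeta)) (starRingEnd ℂ s)
  have e : starRingEnd ℂ ∘ riemannZeta ∘ starRingEnd ℂ = riemannZeta := by
    funext w
    simp [riemannZeta_conj]
  rw [e] at h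
  simpa using h

lemma deriv_riemannZeta_ne_zero_of_im_pos {s : ℂ} (hre : s.re ≤ 0) (him : 0 < s.im) :
    deriv riemannZeta s ≠ 0 := by
  rcases le_total 8 s.im with h8 | h8
  · exact deriv_riemannZeta_ne_zero_of_eight_le_im hre h8
  rcases le_total 3 s.im with h3 | h3
  · exact deriv_riemannZeta_ne_zero_of_im_mem_Icc hre h3 h8
  rcases le_total s.re (-1) with h1 | h1
  · exact deriv_riemannZeta_ne_zero_of_re_le_neg_one h1 him h3
  · exact deriv_riemannZeta_ne_zero_of_neg_one_le_re h1 hre him h3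

theorem theorem5 (s : ℂ) (hs : s.im ≠ 0) (hζ : deriv riemannZeta s = 0) : 0 < s.re := by
  by_contra! hre
  rcases hs.lt_or_gt with h | h
  · refine deriv_riemannZeta_ne_zero_of_im_pos (s := starRingEnd ℂ s) (by simpa using hre)
      (by simpa using h) ?_
    rw [deriv_riemannZeta_conj, hζ, map_zero]
  · exact deriv_riemannZeta_ne_zero_of_im_pos hre h hζ
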